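/- Let $\beta,x_1,x_2,\dots$ be commuting variables. A strict partition is a finite sequence $\lambda=(\lambda_1>\lambda_2>\dots>\lambda_r>0)$ of integers ($r\ge 0$, $\lambda_i:=0$ for $i>r$); its shifted diagram is $\mathsf{SD}_\lambda=\{(i,j): 1\le i\le j<i+\lambda_i\}$ and $|\lambda|=|\mathsf{SD}_\lambda|$. Write $\mu\subseteq\lambda$ if $\mu_i\le\lambda_i$ for all $i$, and $\mathsf{SD}_{\lambda/\mu}=\mathsf{SD}_\lambda\setminus\mathsf{SD}_\mu$, $|\lambda/\mu|=|\mathsf{SD}_{\lambda/\mu}|$. Order the primed and unprimed positive integers as $1'<1<2'<2<\cdots$. A semistandard set-valued shifted tableau $T$ of shape $\lambda$ assigns to each box of $\mathsf{SD}_\lambda$ a nonempty finite set of primed or unprimed positive integers, such that rows and columns are weakly increasing (every element of a set is $\le$ every element of each later set in the same row or column), no unprimed number occurs in two boxes of a column and no primed number occurs in two boxes of a row. Put $$GQ_\lambda=\sum_T\beta^{|T|-|\lambda|}x^T\in\mathbb{Z}[\beta][[x_1,x_2,\dots]],$$ where the sum is over all such $T$, $|T|$ is the total number of entries of $T$, and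 the exponent of $x_i$ in $x^T$ is the number of occurrences of $i$ or $i'$. Let $(gp_\lambda)$ be the unique power series in $\mathbb{Z}[\beta][[x_1,x_2,\dots]]$ indexed by strict partitions with $$\sum_\lambda GQ_\lambda(x)\,gp_\lambda(y)=\prod_{i,j\ge1}\frac{1-\overline{x_i}\,y_j}{1-x_iy_j},\qquad \overline{x}:=\frac{-x}{1+\beta x}.$$ Let $b^\lambda_{\mu\nu}$ be the unique integers, zero when $|\lambda|<|\mu|+|\nu|$, with $GQ_\mu GQ_\nu=\sum_\lambda b^\lambda_{\mu\nu}\beta^{|\lambda|-|\mu|-|\nu|}GQ_\lambda$ (a possibly infinite sum), and set $$gp_{\lambda/\mu}=\sum_\nu b^\lambda_{\mu\nu}\beta^{|\lambda|-|\mu|-|\nu|}gp_\nu,\qquad jp_{\lambda/\mu}=\omega(gp_{\lambda/\mu}),$$ where $\omega$ sends a (possibly infinite) $\mathbb{Z}[\beta]$-linear combination $\sum_\kappa c_\kappa s_\kappa$ of Schur functions to $\sum_\kappa c_\kappa s_{\kappa^\top}$. A shifted bar tableau $T=(V,\Pi)$ of shape $\lambda/\mu$ is a filling $V$ of $\mathsf{SD}_{\lambda/\mu}$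 by primed and unprimed positive integers with weakly increasing rows and columns, no unprimed number repeated in a column and no primed number repeated in a row, together with a partition $\Pi$ of the set $\mathsf{SD}_{\lambda/\mu}$ into blocks, each of which is a set of adjacent (contiguous) boxes with the same entry in $V$. Let $\mathrm{ShBT}_P(\lambda/\mu)$ be the set of those in which no box $(i,i)$ has a primed entry; let $|T|=|\Pi|$, and let the exponent of $x_i$ in $x^T$ be the number of blocks with entry $i$ or $i'$. **Corollary.** Suppose that for all strict partitions $\mu\subseteq\lambda$ $$jp_{\lambda/\mu}=\sum_{T\in\mathrm{ShBT}_P(\lambda/\mu)}(-\beta)^{|\lambda/\mu|-|T|}x^T.$$ Then each product $GQ_\mu GQ_\nu$ is a finite $\mathbb{Z}[\beta]$-linear combination of $GQ_\lambda$'s; precisely, for all strict partitions $\mu,\nu$ only finitely many $b^\lambda_{\mu\nu}$ are nonzero and $GQ_\mu GQ_\nu=\sum_\lambda b^\lambda_{\mu\nu}\beta^{|\lambda|-|\mu|-|\nu|}GQ_\lambda$ is a finite sum. Consequently $\{GQ_\lambda:\lambda\text{ a strict partition}\}$ is a $\mathbb{Z}[\beta]$-basis for a subring of $\mathbb{Z}[\beta][[x_1,x_2,\dots]]$.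 -/

import Mathlib

noncomputable section

namespace KSchur

/-! ### Formal power series -/

/-- The coefficient ring `ℤ[β]`. -/
abbrev Zbeta : Type := Polynomial ℤ

/-- The variable `β`. -/
def beta : Zbeta := Polynomial.X

/-- The ring `ℤ[β][[x₀, x₁, x₂, …]]`; the variable with index `i` here plays the role of
`x_{i+1}` in the usual one-based notation. -/
abbrev PS : Type := MvPowerSeries ℕ Zbeta

section Formal

variable {ι σ : Type*}

/-- The formal sum of a family of power series, computed coefficient by coefficient. -/
def formalSum (F : ι → MvPowerSeries σ Zbeta) : MvPowerSeries σ Zbeta :=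
  fun m => ∑ᶠ i, MvPowerSeries.coeff m (F i)

/-- `f` is the (possibly infinite) formal sum of the family `F`: every monomial occurs in only
finitely many members of the family, and the coefficients add up to those of `f`. -/
def IsFormalSum (F : ι → MvPowerSeries σ Zbeta) (f : MvPowerSeries σ Zbeta) : Prop :=
  (∀ m, {i | MvPowerSeries.coeff m (F i) ≠ 0}.Finite) ∧ f = formalSum F

/-- `f` is the (possibly infinite) formal product of the family `F`: every coefficient of the
finite partial products is eventually equal to that of `f`. -/
def IsFormalProd (F : ι → MvPowerSeries σ Zbeta) (f : MvPowerSeries σ Zbeta) : Prop :=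
  ∀ m, ∀ᶠ s : Finset ι in Filter.atTop,
    MvPowerSeries.coeff m (∏ i ∈ s, F i) = MvPowerSeries.coeff m f

end Formal

/-! ### Strict partitions and shifted diagrams -/

/-- A strict partition: a strictly decreasing finite sequence of positive integers. -/
@[ext]
structure StrictPartition where
  parts : List ℕ
  sorted : parts.Pairwise (· > ·)
  pos : ∀ p ∈ parts, 0 < p

namespace StrictPartition

/-- The `i`-th part (counted from `0`), with the convention that it is `0` beyond the length. -/
def part (lam : StrictPartition) (i : ℕ) : ℕ := lam.parts.getD i 0

/-- The shifted diagram, with rows and columns counted from `0`. -/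
def diagram (lam : StrictPartition) : Finset (ℕ × ℕ) :=
  (Finset.range lam.parts.length).biUnion fun i =>
    (Finset.Ico i (i + lam.part i)).image fun j => (i, j)

theorem mem_diagram (lam : StrictPartition) (p : ℕ × ℕ) :
    p ∈ lam.diagram ↔ p.1 ≤ p.2 ∧ p.2 < p.1 + lam.part p.1 := by
  obtain ⟨i, j⟩ := p
  simp only [diagram, Finset.mem_biUnion, Finset.mem_range, Finset.mem_image, Finset.mem_Ico,
    Prod.mk.injEq]
  constructor
  · rintro ⟨a, _, b, hb, rfl, rfl⟩
    exact hb
  · rintro ⟨h1, h2⟩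
    refine ⟨i, ?_, j, ⟨h1, h2⟩, rfl, rfl⟩
    by_contra hlt
    have h0 : lam.part i = 0 := by
      unfold part
      rw [List.getD_eq_default]
      omega
    omega

/-- The size `|λ|`, the number of boxes of the shifted diagram. -/
def size (lam : StrictPartition) : ℕ := lam.diagram.card

/-- Containment `μ ⊆ λ` of strict partitions. -/
def Contained (mu lam : StrictPartition) : Prop := ∀ i, mu.part i ≤ lam.part i

/-- The skew shifted diagram of `λ/μ`. -/
def skewDiagram (lam mu : StrictPartition) : Finset (ℕ × ℕ) := lam.diagram \ mu.diagram

end StrictPartition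

/-! ### Positive half-integers

The totally ordered set `1' < 1 < 2' < 2 < ⋯` of positive half-integers is encoded by `ℕ`: the
number `e` stands for the half-integer `(e + 1) / 2`.  So `0, 1, 2, 3, …` stand for
`1', 1, 2', 2, …`. -/

/-- Whether the half-integer encoded by `e` is a primed number. -/
def IsPrimed (e : ℕ) : Prop := Even e

/-- The index of the variable attached to the half-integer encoded by `e`: both `1'` and `1` have
the index `0`, both `2'` and `2` have the index `1`, and so on. -/
def varIndex (e : ℕ) : ℕ := e / 2

/-! ### Set-valued shifted tableaux and the functions `GQ` -/

/-- Semistandard set-valued shifted tableaux of shape `λ` (primes are allowed on the diagonal). -/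
structure SetShYT (lam : StrictPartition) where
  entry : lam.diagram → Finset ℕ
  nonempty : ∀ p, (entry p).Nonempty
  row_weak : ∀ p q : lam.diagram, p.1.1 = q.1.1 → p.1.2 < q.1.2 →
    ∀ a ∈ entry p, ∀ b ∈ entry q, a ≤ b
  col_weak : ∀ p q : lam.diagram, p.1.2 = q.1.2 → p.1.1 < q.1.1 →
    ∀ a ∈ entry p, ∀ b ∈ entry q, a ≤ b
  col_unprimed : ∀ p q : lam.diagram, p.1.2 = q.1.2 → p.1.1 < q.1.1 →
    ∀ a ∈ entry p, a ∈ entry q → IsPrimed a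
  row_primed : ∀ p q : lam.diagram, p.1.1 = q.1.1 → p.1.2 < q.1.2 →
    ∀ a ∈ entry p, a ∈ entry q → ¬ IsPrimed a

namespace SetShYT

variable {lam : StrictPartition}

/-- `|T|`, the total number of entries. -/
def size (T : SetShYT lam) : ℕ := ∑ p, (T.entry p).card

/-- The exponent vector of the monomial `x^T`. -/
def weight (T : SetShYT lam) : ℕ →₀ ℕ :=
  ∑ p, ∑ a ∈ T.entry p, Finsupp.single (varIndex a) 1

end SetShYT

/-- The `K`-theoretic Schur `Q`-function `GQ_λ = ∑_T β^(|T|-|λ|) x^T`. -/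
def GQ (lam : StrictPartition) : PS :=
  formalSum fun T : SetShYT lam => MvPowerSeries.monomial T.weight (beta ^ (T.size - lam.size))

/-! ### The dual functions `gp` -/

instance : Filter.TendstoCofinite (Sum.inl : ℕ → ℕ ⊕ ℕ) := ⟨Sum.inl_injective.tendsto_cofinite⟩

instance : Filter.TendstoCofinite (Sum.inr : ℕ → ℕ ⊕ ℕ) := ⟨Sum.inr_injective.tendsto_cofinite⟩

/-- The power series `f(x)`, in the two sets of variables `x` and `y`. -/
def inX (f : PS) : MvPowerSeries (ℕ ⊕ ℕ) Zbeta := MvPowerSeries.rename Sum.inl f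

/-- The power series `f(y)`, in the two sets of variables `x` and `y`. -/
def inY (f : PS) : MvPowerSeries (ℕ ⊕ ℕ) Zbeta := MvPowerSeries.rename Sum.inr f

/-- The factor `(1 - x̄ᵢ yⱼ) / (1 - xᵢ yⱼ)` of the Cauchy kernel, where `x̄ = -x / (1 + β x)`. -/
def cauchyFactor (p : ℕ × ℕ) : MvPowerSeries (ℕ ⊕ ℕ) Zbeta :=
  let x : MvPowerSeries (ℕ ⊕ ℕ) Zbeta := MvPowerSeries.X (Sum.inl p.1)
  let y : MvPowerSeries (ℕ ⊕ ℕ) Zbeta := MvPowerSeries.X (Sum.inr p.2)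
  let xbar := -x * MvPowerSeries.invOfUnit (1 + MvPowerSeries.C beta * x) 1
  (1 - xbar * y) * MvPowerSeries.invOfUnit (1 - x * y) 1

/-- The Cauchy identity `∑_λ GQ_λ(x) gp_λ(y) = ∏_{i,j} (1 - x̄ᵢ yⱼ) / (1 - xᵢ yⱼ)`. -/
def CauchyIdentity (g : StrictPartition → PS) : Prop :=
  ∃ D : MvPowerSeries (ℕ ⊕ ℕ) Zbeta, IsFormalProd cauchyFactor D ∧
    IsFormalSum (fun lam => inX (GQ lam) * inY (g lam)) D

open Classical in
/-- The dual `K`-theoretic Schur `P`-functions `gp_λ`: the unique family of power series that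
satisfies the Cauchy identity. -/
def gp : StrictPartition → PS :=
  if h : ∃ g, CauchyIdentity g then h.choose else 0

/-! ### Products of the functions `GQ` and the skew functions `gp_{λ/μ}` -/

/-- The integers `b λ` are the coefficients in the (possibly infinite) expansion
`GQ_μ GQ_ν = ∑_λ b_λ β^(|λ|-|μ|-|ν|) GQ_λ`.  No negative power of `β` may occur, so
`b λ = 0` when `|λ| < |μ| + |ν|`. -/
def IsProductExpansion (mu nu : StrictPartition) (b : StrictPartition → ℤ) : Prop :=
  (∀ lam, lam.size < mu.size + nu.size → b lam = 0) ∧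
  IsFormalSum (fun lam => ((b lam : Zbeta) * beta ^ (lam.size - mu.size - nu.size)) • GQ lam)
    (GQ mu * GQ nu)

open Classical in
/-- The integers `b^λ_{μν}`: the unique coefficients in the expansion of `GQ_μ GQ_ν`. -/
def bCoeff (mu nu : StrictPartition) : StrictPartition → ℤ :=
  if h : ∃ b, IsProductExpansion mu nu b then h.choose else 0

/-- The skew dual functions `gp_{λ/μ} = ∑_ν b^λ_{μν} β^(|λ|-|μ|-|ν|) gp_ν`; only the finitely many
`ν` with `|μ| + |ν| ≤ |λ|` contribute. -/
def gpSkew (lam mu : StrictPartition) : PS :=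
  ∑ᶠ nu, ((bCoeff mu nu lam : Zbeta) * beta ^ (lam.size - mu.size - nu.size)) • gp nu

/-! ### Schur functions, the operator `ω` and the functions `jp_{λ/μ}` -/

/-- The exponent vector of the monomial `x^T` of a semistandard Young tableau. -/
def ssytWeight {mu : YoungDiagram} (T : SemistandardYoungTableau mu) : ℕ →₀ ℕ :=
  ∑ p ∈ mu.cells, Finsupp.single (T p.1 p.2) 1

/-- The Schur function `s_μ`. -/
def schur (mu : YoungDiagram) : PS :=
  formalSum fun T : SemistandardYoungTableau mu => MvPowerSeries.monomial (ssytWeight T) 1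

/-- `f = ∑_μ c_μ s_μ`, a possibly infinite sum. -/
def IsSchurExpansion (f : PS) (c : YoungDiagram → Zbeta) : Prop :=
  IsFormalSum (fun mu => c mu • schur mu) f

open Classical in
/-- The operator `ω`, which sends a possibly infinite `ℤ[β]`-linear combination `∑_μ c_μ s_μ` to
`∑_μ c_μ s_{μᵀ}` (and, as a convention, every other power series to `0`). -/
def omega (f : PS) : PS :=
  if h : ∃ c, IsSchurExpansion f c then formalSum fun mu => h.choose mu • schur mu.transpose
  else 0

/-- The functions `jp_{λ/μ} = ω(gp_{λ/μ})`. -/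
def jpSkew (lam mu : StrictPartition) : PS := omega (gpSkew lam mu)

/-! ### Shifted bar tableaux -/

/-- Two boxes are adjacent when they share a side. -/
def Adjacent (p q : ℕ × ℕ) : Prop :=
  (p.1 = q.1 ∧ (p.2 + 1 = q.2 ∨ q.2 + 1 = p.2)) ∨
  (p.2 = q.2 ∧ (p.1 + 1 = q.1 ∨ q.1 + 1 = p.1))

/-- Shifted bar tableaux of shape `λ/μ` without primed entries on the diagonal: a semistandard
shifted tableau together with a partition of its set of boxes into blocks, each of which consists
of adjacent (that is, contiguous) boxes with the same entry. -/
structure ShBTP (lam mu : StrictPartition) where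
  entry : lam.skewDiagram mu → ℕ
  row_weak : ∀ p q : lam.skewDiagram mu, p.1.1 = q.1.1 → p.1.2 < q.1.2 → entry p ≤ entry q
  col_weak : ∀ p q : lam.skewDiagram mu, p.1.2 = q.1.2 → p.1.1 < q.1.1 → entry p ≤ entry q
  col_unprimed : ∀ p q : lam.skewDiagram mu, p.1.2 = q.1.2 → p.1.1 < q.1.1 →
    entry p = entry q → IsPrimed (entry p)
  row_primed : ∀ p q : lam.skewDiagram mu, p.1.1 = q.1.1 → p.1.2 < q.1.2 →
    entry p = entry q → ¬ IsPrimed (entry p)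
  diag_unprimed : ∀ p : lam.skewDiagram mu, p.1.1 = p.1.2 → ¬ IsPrimed (entry p)
  blocks : Finpartition (Finset.univ : Finset (lam.skewDiagram mu))
  block_const : ∀ B ∈ blocks.parts, ∀ p ∈ B, ∀ q ∈ B, entry p = entry q
  block_adjacent : ∀ B ∈ blocks.parts, ∀ p ∈ B, ∀ q ∈ B,
    Relation.ReflTransGen (fun a b => a ∈ B ∧ b ∈ B ∧ Adjacent a.1 b.1) p q

namespace ShBTP

variable {lam mu : StrictPartition}

/-- `|T|`, the number of blocks. -/
def size (T : ShBTP lam mu) : ℕ := T.blocks.parts.card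

/-- The exponent vector of the monomial `x^T`: the exponent of the variable with index `i` is the
number of blocks whose boxes contain one of the two half-integers with this index. -/
def weight (T : ShBTP lam mu) : ℕ →₀ ℕ :=
  Finsupp.onFinset (Finset.univ.image fun p => varIndex (T.entry p))
    (fun i => (T.blocks.parts.filter fun B => ∃ p ∈ B, varIndex (T.entry p) = i).card)
    (by
      intro i hi
      obtain ⟨B, hB⟩ := Finset.card_ne_zero.mp hi
      obtain ⟨p, _, hp⟩ := (Finset.mem_filter.mp hB).2
      exact Finset.mem_image.mpr ⟨p, Finset.mem_univ p, hp⟩)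

end ShBTP

/-- The generating function `∑_T (-β)^(|λ/μ|-|T|) x^T` over the shifted bar tableaux of shape
`λ/μ` without primed entries on the diagonal. -/
def barGenFun (lam mu : StrictPartition) : PS :=
  formalSum fun T : ShBTP lam mu =>
    MvPowerSeries.monomial T.weight ((-beta) ^ ((lam.skewDiagram mu).card - T.size))

/-- The conjectural formula for `jp_{λ/μ}`, for all strict partitions `μ ⊆ λ`. -/
def JpFormula : Prop :=
  ∀ lam mu : StrictPartition, mu.Contained lam → jpSkew lam mu = barGenFun lam mu

end KSchur

end

/-!
The product `GQ_μ GQ_ν` has an expansion into functions `GQ_λ` for a formal reason, and it is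
finite because of the role of the first variable.

*Existence.*  The formula for `jp_{λ/μ}` is only needed for `μ = ∅`.  There `gp_{λ/∅} = gp_λ`, and
the formula reads `ω(gp_λ) = ∑_T (-β)^(|λ|-|T|) x^T`.  The right-hand side is not zero, so the
formula contains the statements that the Cauchy identity has a solution and that `gp_λ` has a Schur
expansion (`cauchyIdentity_gp`, `exists_isSchurExpansion_gp`).  The generating functions of shifted
bar tableaux are unitriangular with respect to the monomials `x^κ`, for `κ` a strict partition, and
Schur functions are unitriangular as well, so that every coefficient of `ω(f)` is a finite linear
combination of coefficients of `f` (`exists_omega_functional`).  Hence there are finite linear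
combinations of coefficients that separate the functions `gp_λ` (`exists_dual_functional`).  Applied
to the Cauchy identity in the variables `y`, they show that every `GQ_κ` is, up to any given degree,
a linear combination of the coefficients `[y^α] K(x, y)` of the Cauchy kernel (`exists_approx_GQ`).
The kernel is a product over the variables `y`, so these coefficients are closed under
multiplication (`exists_coeff_kernel_mul`), and by the Cauchy identity each of them is an infinite
linear combination of functions `GQ_λ`.  Therefore so is `GQ_μ GQ_ν`; homogeneity shows that the
coefficients are integers times powers of `β`.

*Finiteness.*  In a set-valued shifted tableau the entries `1'` and `1` lie in the first row, and
only the first box of the diagonal may contain `1'`.  Toggling `{1'}`, `{1}` and `{1', 1}` in this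
box shows that `GQ_λ` becomes independent of the first variable `x` modulo
`x ⊕ x = 2x + βx²` (`GQ_mem_doubleVarSubalgebra`), and counting shows that `GQ_λ` has degree at
most `λ₁ + 1` in `x` (`degreeLE_GQ`).  Let `f` be a power series with these two properties, with `N`
as the bound for the degree, and consider an expansion of `f` into functions `GQ_λ`.  Subtracting
the finitely many terms with `λ₁ < N` preserves both properties.  If terms with `λ₁ ≥ N` are left,
the leading monomial `x^λ` of the difference is divisible by the `N`-th power of the first variable,
and its cofactor in the remaining variables occurs in the difference only with this power `x^N`.
But a monomial `c x^N` with `c ≠ 0` is not divisible by `2 + βx` (`false_of_leading`).  So only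
strict partitions with `λ₁ < N` occur, and there are finitely many of these.
-/

noncomputable section

namespace KSchur

open MvPowerSeries (coeff monomial)

/-! ### Exponent vectors and dominance -/

/-- The partial sums `m₀ + ⋯ + m_{k-1}` of an exponent vector.  Dominance of exponent vectors is
the pointwise order of these functions. -/
def psum (m : ℕ →₀ ℕ) (k : ℕ) : ℕ := ∑ i ∈ Finset.range k, m i

theorem psum_succ (m : ℕ →₀ ℕ) (k : ℕ) : psum m (k + 1) = psum m k + m k :=
  Finset.sum_range_succ _ _

theorem psum_injective : Function.Injective psum := by
  intro m n h
  ext k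
  have h1 := congrFun h (k + 1)
  have h2 := congrFun h k
  rw [psum_succ, psum_succ] at h1
  omega

theorem psum_add (m n : ℕ →₀ ℕ) (k : ℕ) : psum (m + n) k = psum m k + psum n k := by
  simp [psum, Finset.sum_add_distrib]

theorem psum_sum {ι : Type*} (s : Finset ι) (f : ι → ℕ →₀ ℕ) (k : ℕ) :
    psum (∑ i ∈ s, f i) k = ∑ i ∈ s, psum (f i) k := by
  classical
  induction s using Finset.induction_on with
  | empty => simp [psum]
  | insert a s ha ih => rw [Finset.sum_insert ha, Finset.sum_insert ha, psum_add, ih]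

theorem psum_single (i k : ℕ) : psum (Finsupp.single i 1) k = if i < k then 1 else 0 := by
  simp [psum, Finsupp.single_apply]

theorem psum_le_degree (m : ℕ →₀ ℕ) (k : ℕ) : psum m k ≤ m.degree := by
  rw [psum, Finsupp.degree_apply]
  calc ∑ i ∈ Finset.range k, m i ≤ ∑ i ∈ Finset.range k ∪ m.support, m i :=
        Finset.sum_le_sum_of_subset Finset.subset_union_left
    _ = ∑ i ∈ m.support, m i := by
        refine (Finset.sum_subset Finset.subset_union_right fun x _ hx => ?_).symm
        simpa using hx

theorem exists_psum_eq_degree (m : ℕ →₀ ℕ) : ∃ k, psum m k = m.degree := by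
  obtain ⟨N, hN⟩ := m.support.exists_nat_subset_range
  refine ⟨N, ?_⟩
  rw [psum, Finsupp.degree_apply]
  refine (Finset.sum_subset hN fun x _ hx => ?_).symm
  simpa using hx

theorem degree_le_of_psum_le {m n : ℕ →₀ ℕ} (h : psum m ≤ psum n) : m.degree ≤ n.degree := by
  obtain ⟨k, hk⟩ := exists_psum_eq_degree m
  rw [← hk]
  exact (h k).trans (psum_le_degree n k)

/-- A matrix that is unitriangular for the dominance order of the exponent vectors attached to
its rows has a left inverse. -/
theorem exists_left_inverse_of_dominance {R ι : Type*} [CommRing R] [Fintype ι] [DecidableEq ι]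
    (e : ι → ℕ →₀ ℕ) (he : Function.Injective e) (K : ι → ι → R) (h1 : ∀ i, K i i = 1)
    (h2 : ∀ i j, K i j ≠ 0 → psum (e i) ≤ psum (e j)) (i : ι) :
    ∃ l : ι → R, ∀ j, ∑ k, l k * K k j = if i = j then 1 else 0 := by
  classical
  have wf : WellFounded fun a b : ι => psum (e b) < psum (e a) :=
    @Finite.wellFounded_of_trans_of_irrefl ι _ _ ⟨fun _ _ _ h h' => h'.trans h⟩
      ⟨fun _ h => lt_irrefl _ h⟩
  induction i using wf.induction with
  | _ i ih =>
  choose! l hl using ih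
  refine ⟨fun k => (if k = i then 1 else 0) -
    ∑ a ∈ Finset.univ.filter (fun a => a ≠ i ∧ K i a ≠ 0), K i a * l a k, fun j => ?_⟩
  have hlt : ∀ a ∈ Finset.univ.filter (fun a => a ≠ i ∧ K i a ≠ 0), psum (e i) < psum (e a) := by
    intro a ha
    obtain ⟨-, hne, hK⟩ := Finset.mem_filter.mp ha
    exact lt_of_le_of_ne (h2 i a hK) fun h => hne (he (psum_injective h)).symm
  have hsum : ∑ k, (∑ a ∈ Finset.univ.filter (fun a => a ≠ i ∧ K i a ≠ 0), K i a * l a k) * K k j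
      = ∑ a ∈ Finset.univ.filter (fun a => a ≠ i ∧ K i a ≠ 0), if a = j then K i a else 0 := by
    simp_rw [Finset.sum_mul]
    rw [Finset.sum_comm]
    refine Finset.sum_congr rfl fun a ha => ?_
    simp_rw [mul_assoc]
    rw [← Finset.mul_sum, hl a (hlt a ha) j]
    split_ifs <;> simp
  simp_rw [sub_mul]
  rw [Finset.sum_sub_distrib, hsum]
  simp only [ite_mul, one_mul, zero_mul, Finset.sum_ite_eq', Finset.mem_univ, if_true,
    Finset.mem_filter, true_and]
  by_cases hij : i = j
  · subst hij
    simp [h1]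
  · have hji : j ≠ i := fun h => hij h.symm
    by_cases hK : K i j = 0
    · simp [hij, hK]
    · simp [hij, hji, hK]

/-! ### Strict partitions -/

namespace StrictPartition

theorem part_eq_zero {lam : StrictPartition} {i : ℕ} (h : lam.parts.length ≤ i) :
    lam.part i = 0 := by
  unfold part
  rw [List.getD_eq_default _ _ h]

theorem part_eq_getElem {lam : StrictPartition} {i : ℕ} (h : i < lam.parts.length) :
    lam.part i = lam.parts[i] := by
  unfold part
  rw [List.getD_eq_getElem _ _ h]

theorem part_pos_iff {lam : StrictPartition} {i : ℕ} : 0 < lam.part i ↔ i < lam.parts.length := by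
  constructor
  · intro h
    by_contra hlt
    rw [part_eq_zero (not_lt.mp hlt)] at h
    exact lt_irrefl _ h
  · intro h
    rw [part_eq_getElem h]
    exact lam.pos _ (List.getElem_mem h)

theorem part_lt {lam : StrictPartition} {i j : ℕ} (hij : i < j) (hj : 0 < lam.part j) :
    lam.part j < lam.part i := by
  have hj' := part_pos_iff.mp hj
  rw [part_eq_getElem hj', part_eq_getElem (hij.trans hj')]
  exact List.pairwise_iff_getElem.mp lam.sorted i j _ _ hij

theorem part_le_part_zero (lam : StrictPartition) (i : ℕ) : lam.part i ≤ lam.part 0 := by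
  rcases Nat.eq_zero_or_pos (lam.part i) with h | h
  · omega
  · rcases Nat.eq_zero_or_pos i with rfl | hi
    · exact le_rfl
    · exact (part_lt hi h).le

theorem mem_parts_iff {lam : StrictPartition} {x : ℕ} :
    x ∈ lam.parts ↔ 0 < x ∧ ∃ i, lam.part i = x := by
  constructor
  · intro h
    obtain ⟨i, hi, rfl⟩ := List.getElem_of_mem h
    exact ⟨lam.pos _ h, i, part_eq_getElem hi⟩
  · rintro ⟨h0, i, rfl⟩
    rw [part_eq_getElem (part_pos_iff.mp h0)]
    exact List.getElem_mem _

theorem nodup_parts (lam : StrictPartition) : lam.parts.Nodup :=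
  lam.sorted.imp fun h => (Nat.ne_of_lt h).symm

theorem toFinset_parts_injective :
    Function.Injective fun lam : StrictPartition => lam.parts.toFinset := by
  intro lam mu h
  ext1
  have hp := List.perm_of_nodup_nodup_toFinset_eq lam.nodup_parts mu.nodup_parts h
  exact hp.eq_of_pairwise (fun a b _ _ h1 h2 => absurd h1 (not_lt.mpr (le_of_lt h2)))
    lam.sorted mu.sorted

theorem finite_part_zero_le (N : ℕ) : {lam : StrictPartition | lam.part 0 ≤ N}.Finite := by
  refine Set.Finite.of_finite_image (f := fun lam => lam.parts.toFinset)
    (Set.Finite.subset (Finset.range (N + 1)).powerset.finite_toSet ?_)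
    toFinset_parts_injective.injOn
  rintro _ ⟨lam, hlam, rfl⟩
  simp only [Finset.coe_powerset, Set.mem_preimage, Set.mem_powerset_iff, Finset.coe_subset]
  intro x hx
  obtain ⟨-, i, rfl⟩ := mem_parts_iff.mp (List.mem_toFinset.mp hx)
  have := lam.part_le_part_zero i
  exact Finset.mem_range.mpr (Nat.lt_succ_of_le (this.trans hlam))

/-- The exponent vector of the monomial `x^λ`. -/
def expo (lam : StrictPartition) : ℕ →₀ ℕ :=
  Finsupp.onFinset (Finset.range lam.parts.length) lam.part fun _ hi =>
    Finset.mem_range.mpr (part_pos_iff.mp (Nat.pos_of_ne_zero hi))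

@[simp]
theorem expo_apply (lam : StrictPartition) (i : ℕ) : lam.expo i = lam.part i := rfl

theorem expo_injective : Function.Injective expo := by
  intro lam mu h
  apply toFinset_parts_injective
  have hp : ∀ i, lam.part i = mu.part i := fun i => DFunLike.congr_fun h i
  ext x
  simp [mem_parts_iff, hp]

theorem card_filter_diagram_row (lam : StrictPartition) (i : ℕ) :
    (lam.diagram.filter fun p => p.1 = i).card = lam.part i := by
  have h : (lam.diagram.filter fun p => p.1 = i) =
      (Finset.Ico i (i + lam.part i)).image fun j => (i, j) := by
    ext ⟨a, b⟩
    simp only [Finset.mem_filter, mem_diagram, Finset.mem_image, Finset.mem_Ico, Prod.mk.injEq]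
    constructor
    · rintro ⟨h, rfl⟩
      exact ⟨b, h, rfl, rfl⟩
    · rintro ⟨b, h, rfl, rfl⟩
      exact ⟨h, rfl⟩
  rw [h, Finset.card_image_of_injective _ (fun a b h => (Prod.mk.inj h).2)]
  simp

theorem psum_expo (lam : StrictPartition) (k : ℕ) :
    psum lam.expo k = (lam.diagram.filter fun p => p.1 < k).card := by
  rw [Finset.card_eq_sum_card_fiberwise (f := Prod.fst) (t := Finset.range k)
    (fun p hp => by simpa using (Finset.mem_filter.mp hp).2)]
  refine Finset.sum_congr rfl fun i hi => ?_
  rw [Finset.filter_filter, expo_apply, ← card_filter_diagram_row]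
  congr 1
  ext p
  simp only [Finset.mem_filter, Finset.mem_range] at hi ⊢
  constructor
  · rintro ⟨h1, h2⟩
    exact ⟨h1, by omega, h2⟩
  · rintro ⟨h1, -, h2⟩
    exact ⟨h1, h2⟩

theorem psum_expo_le (lam : StrictPartition) (k : ℕ) : psum lam.expo k ≤ lam.size := by
  rw [psum_expo]
  exact Finset.card_filter_le _ _

theorem degree_expo (lam : StrictPartition) : lam.expo.degree = lam.size := by
  refine le_antisymm ?_ ?_
  · obtain ⟨k, hk⟩ := exists_psum_eq_degree lam.expo
    rw [← hk]
    exact lam.psum_expo_le k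
  · refine le_trans ?_ (psum_le_degree lam.expo lam.parts.length)
    rw [psum_expo, size, Finset.filter_true_of_mem]
    intro p hp
    rw [mem_diagram] at hp
    exact part_pos_iff.mp (by omega)

theorem part_zero_le_size (lam : StrictPartition) : lam.part 0 ≤ lam.size := by
  rw [← card_filter_diagram_row]
  exact Finset.card_filter_le _ _

theorem finite_size_le (d : ℕ) : {lam : StrictPartition | lam.size ≤ d}.Finite :=
  (finite_part_zero_le d).subset fun lam h => lam.part_zero_le_size.trans h

theorem diagram_up {lam : StrictPartition} {i j : ℕ} (h : (i + 1, j) ∈ lam.diagram) :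
    (i, j) ∈ lam.diagram := by
  rw [mem_diagram] at h ⊢
  have := part_lt (lam := lam) (Nat.lt_add_one i) (by dsimp only at h; omega)
  dsimp only at h ⊢
  omega

theorem diagram_left {lam : StrictPartition} {i j : ℕ} (h : (i, j + 1) ∈ lam.diagram)
    (hij : i ≤ j) : (i, j) ∈ lam.diagram := by
  rw [mem_diagram] at h ⊢
  simp only at *
  omega

theorem diagram_top {lam : StrictPartition} {i j : ℕ} (h : (i, j) ∈ lam.diagram) :
    (0, j) ∈ lam.diagram := by
  induction i with
  | zero => exact h
  | succ i ih => exact ih (diagram_up h)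

theorem diagram_corner {lam : StrictPartition} {i j : ℕ} (h : (i, j) ∈ lam.diagram) :
    (0, 0) ∈ lam.diagram := by
  have := diagram_top h
  rw [mem_diagram] at this ⊢
  simp only at *
  omega

/-- The empty partition. -/
def empty : StrictPartition := ⟨[], List.Pairwise.nil, by simp⟩

theorem part_empty (i : ℕ) : empty.part i = 0 := by simp [part, empty]

theorem diagram_empty : empty.diagram = ∅ := by simp [diagram, empty]

theorem size_empty : empty.size = 0 := by simp [size, diagram_empty]

theorem skewDiagram_empty (lam : StrictPartition) : lam.skewDiagram empty = lam.diagram := by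
  simp [skewDiagram, diagram_empty]

theorem empty_contained (lam : StrictPartition) : empty.Contained lam := fun i => by
  simp [part_empty]

end StrictPartition

/-! ### Semistandard fillings of shifted diagrams -/

/-- The semistandardness conditions for a filling of a set of boxes with sets of half-integers;
`E p` is the set of entries of the box `p`. -/
structure ShiftedFilling (S : Finset (ℕ × ℕ)) (E : ℕ × ℕ → Set ℕ) : Prop where
  nonempty : ∀ p ∈ S, (E p).Nonempty
  row_weak : ∀ p ∈ S, ∀ q ∈ S, p.1 = q.1 → p.2 < q.2 → ∀ a ∈ E p, ∀ b ∈ E q, a ≤ b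
  col_weak : ∀ p ∈ S, ∀ q ∈ S, p.2 = q.2 → p.1 < q.1 → ∀ a ∈ E p, ∀ b ∈ E q, a ≤ b
  col_unprimed : ∀ p ∈ S, ∀ q ∈ S, p.2 = q.2 → p.1 < q.1 → ∀ a ∈ E p, a ∈ E q → IsPrimed a
  row_primed : ∀ p ∈ S, ∀ q ∈ S, p.1 = q.1 → p.2 < q.2 → ∀ a ∈ E p, a ∈ E q → ¬ IsPrimed a

/-- The entries in row `i` of a semistandard filling of a shifted diagram are at least `(i+1)'`. -/
theorem ShiftedFilling.two_mul_row_le {lam : StrictPartition} {E : ℕ × ℕ → Set ℕ}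
    (h : ShiftedFilling lam.diagram E) (i j : ℕ) (hp : (i, j) ∈ lam.diagram) (b : ℕ)
    (hb : b ∈ E (i, j)) : 2 * i ≤ b := by
  induction i generalizing j b with
  | zero => omega
  | succ i ih =>
    have hij : i + 1 ≤ j := ((lam.mem_diagram _).mp hp).1
    obtain ⟨j, rfl⟩ : ∃ k, j = k + 1 := ⟨j - 1, by omega⟩
    have hq := StrictPartition.diagram_up hp
    have hr := StrictPartition.diagram_left hq (by omega)
    obtain ⟨c, hc⟩ := h.nonempty _ hq
    obtain ⟨a, ha⟩ := h.nonempty _ hr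
    have h1 := ih j hr a ha
    have h2 := h.row_weak _ hr _ hq rfl (Nat.lt_succ_self j) a ha c hc
    have h3 := h.col_weak _ hq _ hp rfl (Nat.lt_succ_self i) c hc b hb
    -- The box above and the box diagonally before are squeezed into `{(i+1)', i+1}` otherwise.
    by_contra hlt
    have hac : a = c → ¬ IsPrimed a := fun e =>
      h.row_primed _ hr _ hq rfl (Nat.lt_succ_self j) a ha (e ▸ hc)
    have hcb : c = b → IsPrimed c := fun e =>
      h.col_unprimed _ hq _ hp rfl (Nat.lt_succ_self i) c hc (e ▸ hb)
    simp only [IsPrimed, Nat.even_iff] at hac hcb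
    omega

/-! ### The coefficients of `GQ` -/

namespace SetShYT

variable {lam : StrictPartition}

@[ext]
theorem ext_entry {T U : SetShYT lam} (h : ∀ p, T.entry p = U.entry p) : T = U := by
  cases T
  cases U
  congr
  exact funext h

/-- The set of entries of a box, as a function on all of `ℕ × ℕ`. -/
def set (T : SetShYT lam) (p : ℕ × ℕ) : Set ℕ := {a | ∃ h : p ∈ lam.diagram, a ∈ T.entry ⟨p, h⟩}

theorem shiftedFilling (T : SetShYT lam) : ShiftedFilling lam.diagram T.set where
  nonempty p hp := (T.nonempty ⟨p, hp⟩).imp fun _ ha => ⟨hp, ha⟩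
  row_weak := fun _ hp _ hq h1 h2 _ ⟨_, ha⟩ _ ⟨_, hb⟩ =>
    T.row_weak ⟨_, hp⟩ ⟨_, hq⟩ h1 h2 _ ha _ hb
  col_weak := fun _ hp _ hq h1 h2 _ ⟨_, ha⟩ _ ⟨_, hb⟩ =>
    T.col_weak ⟨_, hp⟩ ⟨_, hq⟩ h1 h2 _ ha _ hb
  col_unprimed := fun _ hp _ hq h1 h2 _ ⟨_, ha⟩ ⟨_, hb⟩ =>
    T.col_unprimed ⟨_, hp⟩ ⟨_, hq⟩ h1 h2 _ ha hb
  row_primed := fun _ hp _ hq h1 h2 _ ⟨_, ha⟩ ⟨_, hb⟩ =>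
    T.row_primed ⟨_, hp⟩ ⟨_, hq⟩ h1 h2 _ ha hb

theorem two_mul_row_le (T : SetShYT lam) (p : lam.diagram) {a : ℕ} (ha : a ∈ T.entry p) :
    2 * p.1.1 ≤ a :=
  T.shiftedFilling.two_mul_row_le p.1.1 p.1.2 p.2 a ⟨p.2, ha⟩

theorem psum_weight (T : SetShYT lam) (k : ℕ) :
    psum T.weight k = ∑ p, ((T.entry p).filter fun a => varIndex a < k).card := by
  rw [weight, psum_sum]
  refine Finset.sum_congr rfl fun p _ => ?_
  rw [psum_sum, Finset.card_filter]
  exact Finset.sum_congr rfl fun a _ => psum_single _ _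

theorem degree_weight (T : SetShYT lam) : T.weight.degree = T.size := by
  simp [weight, size, Finsupp.degree_single]

theorem size_le (T : SetShYT lam) : lam.size ≤ T.size := by
  rw [StrictPartition.size, ← Fintype.card_coe, ← Finset.card_univ, Finset.card_eq_sum_ones]
  exact Finset.sum_le_sum fun p _ => Finset.card_pos.mpr (T.nonempty p)

theorem finite_weight_eq (lam : StrictPartition) (m : ℕ →₀ ℕ) :
    {T : SetShYT lam | T.weight = m}.Finite := by
  obtain ⟨N, hN⟩ := m.support.exists_nat_subset_range
  have hf : {f : lam.diagram → Finset ℕ | ∀ p, f p ∈ (Finset.range (2 * N)).powerset}.Finite :=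
    Set.Finite.pi' fun _ => Finset.finite_toSet _
  refine Set.Finite.of_finite_image (f := SetShYT.entry) (hf.subset ?_)
    fun T _ U _ h => ext_entry (congrFun h)
  rintro _ ⟨T, rfl, rfl⟩ p
  refine Finset.mem_powerset.mpr fun a ha => ?_
  have hs : varIndex a ∈ T.weight.support := by
    have : 0 < ∑ p, ∑ b ∈ T.entry p, (Finsupp.single (varIndex b) 1 : ℕ →₀ ℕ) (varIndex a) :=
      Finset.sum_pos' (fun _ _ => Nat.zero_le _) ⟨p, Finset.mem_univ _,
        Finset.sum_pos' (fun _ _ => Nat.zero_le _) ⟨a, ha, by simp⟩⟩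
    rw [Finsupp.mem_support_iff, weight]
    simp only [Finsupp.finsetSum_apply]
    exact this.ne'
  have := Finset.mem_range.mp (hN hs)
  simp only [varIndex] at this
  exact Finset.mem_range.mpr (by omega)

end SetShYT

/-- The number of set-valued shifted tableaux with a given shape and weight. -/
def gqCount (lam : StrictPartition) (m : ℕ →₀ ℕ) : ℕ := {T : SetShYT lam | T.weight = m}.ncard

theorem coeff_GQ (lam : StrictPartition) (m : ℕ →₀ ℕ) :
    coeff m (GQ lam) = (gqCount lam m : Zbeta) * beta ^ (m.degree - lam.size) := by
  classical
  have hfin := SetShYT.finite_weight_eq lam m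
  change ∑ᶠ T : SetShYT lam, coeff m (monomial T.weight (beta ^ (T.size - lam.size))) = _
  rw [finsum_eq_sum_of_support_subset (s := hfin.toFinset)]
  · rw [Finset.sum_congr rfl (g := fun _ => beta ^ (m.degree - lam.size)), Finset.sum_const,
      gqCount, Set.ncard_eq_toFinset_card _ hfin, nsmul_eq_mul]
    intro T hT
    have hT' : T.weight = m := by simpa using hT
    rw [← hT', MvPowerSeries.coeff_monomial_same, T.degree_weight]
  · intro T hT
    rw [Function.mem_support, MvPowerSeries.coeff_monomial] at hT
    have : m = T.weight := by
      by_contra h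
      exact hT (if_neg h)
    simp [this]

theorem exists_of_coeff_GQ_ne_zero {lam : StrictPartition} {m : ℕ →₀ ℕ}
    (h : coeff m (GQ lam) ≠ 0) : ∃ T : SetShYT lam, T.weight = m := by
  rw [coeff_GQ] at h
  by_contra hT
  push Not at hT
  refine h ?_
  simp [gqCount, hT]

theorem size_le_of_coeff_GQ_ne_zero {lam : StrictPartition} {m : ℕ →₀ ℕ}
    (h : coeff m (GQ lam) ≠ 0) : lam.size ≤ m.degree := by
  obtain ⟨T, rfl⟩ := exists_of_coeff_GQ_ne_zero h
  rw [T.degree_weight]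
  exact T.size_le

/-- The part of lowest degree of `GQ_λ` only involves monomials that are dominated by `x^λ`. -/
theorem psum_le_of_coeff_GQ_ne_zero {lam : StrictPartition} {m : ℕ →₀ ℕ}
    (h : coeff m (GQ lam) ≠ 0) (hm : m.degree = lam.size) : psum m ≤ psum lam.expo := by
  obtain ⟨T, rfl⟩ := exists_of_coeff_GQ_ne_zero h
  rw [T.degree_weight] at hm
  -- All boxes have a single entry, since the number of entries is the number of boxes.
  have hcard : ∀ p, (T.entry p).card = 1 := by
    have h1 : ∑ _p : lam.diagram, 1 = ∑ p, (T.entry p).card := by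
      rw [← SetShYT.size, hm, ← Finset.card_eq_sum_ones, Finset.card_univ, Fintype.card_coe,
        StrictPartition.size]
    intro p
    exact ((Finset.sum_eq_sum_iff_of_le fun p _ => Finset.card_pos.mpr (T.nonempty p)).mp h1 p
      (Finset.mem_univ p)).symm
  intro k
  rw [T.psum_weight, StrictPartition.psum_expo, Finset.card_filter, 
    ← Finset.sum_coe_sort lam.diagram fun p => if p.1 < k then 1 else 0]
  refine Finset.sum_le_sum fun p _ => ?_
  split_ifs with hp
  · exact (Finset.card_filter_le _ _).trans (hcard p).le
  · rw [Nat.le_zero, Finset.card_eq_zero, Finset.filter_eq_empty_iff]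
    intro a ha hak
    have := T.two_mul_row_le p ha
    simp only [varIndex] at hak
    omega

theorem coeff_expo_GQ_ne_zero (lam : StrictPartition) : coeff lam.expo (GQ lam) ≠ 0 := by
  classical
  let T : SetShYT lam :=
    { entry := fun p => {2 * p.1.1 + 1}
      nonempty := fun p => Finset.singleton_nonempty _
      row_weak := fun p q h _ a ha b hb => by
        rw [Finset.mem_singleton] at ha hb
        omega
      col_weak := fun p q _ h a ha b hb => by
        rw [Finset.mem_singleton] at ha hb
        omega
      col_unprimed := fun p q _ h a ha hb => by
        rw [Finset.mem_singleton] at ha hb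
        omega
      row_primed := fun p q _ _ a ha _ => by
        rw [Finset.mem_singleton] at ha
        rw [ha, IsPrimed, Nat.even_iff]
        omega }
  have hT : T.weight = lam.expo := by
    apply psum_injective
    funext k
    rw [T.psum_weight, StrictPartition.psum_expo, Finset.card_filter, 
    ← Finset.sum_coe_sort lam.diagram fun p => if p.1 < k then 1 else 0]
    refine Finset.sum_congr rfl fun p _ => ?_
    change (Finset.filter _ {2 * p.1.1 + 1}).card = _
    have hv : varIndex (2 * p.1.1 + 1) = p.1.1 := by
      unfold varIndex
      omega
    rw [Finset.filter_singleton, hv]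
    split_ifs <;> simp
  rw [coeff_GQ, StrictPartition.degree_expo, Nat.sub_self, pow_zero, mul_one]
  refine Nat.cast_ne_zero.mpr (Set.ncard_ne_zero_of_mem (a := T) hT ?_)
  exact SetShYT.finite_weight_eq lam _

theorem GQ_empty : GQ StrictPartition.empty = 1 := by
  classical
  have hE : IsEmpty (StrictPartition.empty.diagram) := by
    rw [StrictPartition.diagram_empty]
    infer_instance
  refine MvPowerSeries.ext fun m => ?_
  rw [MvPowerSeries.coeff_one]
  split_ifs with hm
  · have h0 : StrictPartition.empty.expo = 0 := by
      ext i
      simp [StrictPartition.part_empty]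
    have h1 : gqCount StrictPartition.empty m ≤ 1 :=
      (Set.ncard_le_one (SetShYT.finite_weight_eq _ _)).mpr fun T _ U _ =>
        SetShYT.ext_entry fun p => hE.elim p
    have h2 := coeff_expo_GQ_ne_zero StrictPartition.empty
    rw [coeff_GQ, h0] at h2
    have h3 : gqCount StrictPartition.empty 0 ≠ 0 := fun h => h2 (by simp [h])
    subst hm
    have h4 : gqCount StrictPartition.empty 0 = 1 := by omega
    rw [coeff_GQ, h4]
    simp
  · by_contra h
    obtain ⟨T, rfl⟩ := exists_of_coeff_GQ_ne_zero h
    exact hm (by simp [SetShYT.weight])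

/-! ### The first variable in `GQ` -/

/-- The entries `1'` and `1`, which are the ones that contribute to the first variable. -/
def ones : Finset ℕ := {0, 1}

theorem mem_ones {a : ℕ} : a ∈ ones ↔ a ≤ 1 := by
  simp only [ones, Finset.mem_insert, Finset.mem_singleton]
  omega

namespace SetShYT

variable {lam : StrictPartition}

theorem psum_weight_one (T : SetShYT lam) : T.weight 0 = psum T.weight 1 := by
  simp [psum]

theorem one_le_of_ne_corner (T : SetShYT lam) (p : lam.diagram) (hp : p.1 ≠ (0, 0)) {a : ℕ}
    (ha : a ∈ T.entry p) : 1 ≤ a := by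
  obtain ⟨⟨i, j⟩, hij⟩ := p
  rcases Nat.eq_zero_or_pos i with rfl | hi
  · have hj : 0 < j := by
      rcases Nat.eq_zero_or_pos j with rfl | hj
      · exact absurd rfl hp
      · exact hj
    have h0 := StrictPartition.diagram_corner hij
    obtain ⟨b, hb⟩ := T.nonempty ⟨_, h0⟩
    have h1 := T.row_weak ⟨_, h0⟩ ⟨_, hij⟩ rfl hj b hb a ha
    by_contra hlt
    have hb0 : b = a := by omega
    refine T.row_primed ⟨_, h0⟩ ⟨_, hij⟩ rfl hj b hb (hb0 ▸ ha) ?_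
    rw [IsPrimed, Nat.even_iff]
    omega
  · have := T.two_mul_row_le _ ha
    dsimp only at this
    omega

/-- The entries `1'` and `1` of the first box of the diagonal. -/
def corner (T : SetShYT lam) : Finset ℕ :=
  if h : (0, 0) ∈ lam.diagram then T.entry ⟨_, h⟩ ∩ ones else ∅

theorem corner_subset (T : SetShYT lam) : T.corner ⊆ ones := by
  unfold corner
  split_ifs
  · exact Finset.inter_subset_right
  · exact Finset.empty_subset _

theorem mem_diagram_of_corner {T : SetShYT lam} (h : T.corner.Nonempty) :
    (0, 0) ∈ lam.diagram := by
  by_contra h0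
  rw [corner, dif_neg h0] at h
  exact Finset.not_nonempty_empty h

/-- Replacing the entries `1'` and `1` of the first box of the diagonal by another nonempty set of
such entries; the other boxes are not affected, since none of them contains `1'`. -/
def setCorner (T : SetShYT lam) (s : Finset ℕ) (hs : s.Nonempty) (hs' : s ⊆ ones) :
    SetShYT lam where
  entry p := if p.1 = (0, 0) then T.entry p \ ones ∪ s else T.entry p
  nonempty p := by
    split_ifs
    · exact hs.mono Finset.subset_union_right
    · exact T.nonempty p
  row_weak p q h1 h2 a ha b hb := by
    have hq : q.1 ≠ (0, 0) := fun h => by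
      rw [h] at h2
      exact absurd h2 (Nat.not_lt_zero _)
    rw [if_neg hq] at hb
    split_ifs at ha with hp
    · rcases Finset.mem_union.mp ha with ha | ha
      · exact T.row_weak p q h1 h2 a (Finset.mem_sdiff.mp ha).1 b hb
      · exact (mem_ones.mp (hs' ha)).trans (T.one_le_of_ne_corner q hq hb)
    · exact T.row_weak p q h1 h2 a ha b hb
  col_weak p q h1 h2 a ha b hb := by
    have hq : q.1 ≠ (0, 0) := fun h => by
      rw [h] at h2
      exact absurd h2 (Nat.not_lt_zero _)
    have hp : p.1 ≠ (0, 0) := fun h => by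
      have := ((lam.mem_diagram _).mp q.2).1
      rw [h] at h1 h2
      dsimp only at h1 h2
      omega
    rw [if_neg hq] at hb
    rw [if_neg hp] at ha
    exact T.col_weak p q h1 h2 a ha b hb
  col_unprimed p q h1 h2 a ha hb := by
    have hq : q.1 ≠ (0, 0) := fun h => by
      rw [h] at h2
      exact absurd h2 (Nat.not_lt_zero _)
    have hp : p.1 ≠ (0, 0) := fun h => by
      have := ((lam.mem_diagram _).mp q.2).1
      rw [h] at h1 h2
      dsimp only at h1 h2
      omega
    rw [if_neg hq] at hb
    rw [if_neg hp] at ha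
    exact T.col_unprimed p q h1 h2 a ha hb
  row_primed p q h1 h2 a ha hb := by
    have hq : q.1 ≠ (0, 0) := fun h => by
      rw [h] at h2
      exact absurd h2 (Nat.not_lt_zero _)
    rw [if_neg hq] at hb
    split_ifs at ha with hp
    · rcases Finset.mem_union.mp ha with ha | ha
      · exact T.row_primed p q h1 h2 a (Finset.mem_sdiff.mp ha).1 hb
      · have h3 := mem_ones.mp (hs' ha)
        have h4 := T.one_le_of_ne_corner q hq hb
        rw [IsPrimed, Nat.even_iff]
        omega
    · exact T.row_primed p q h1 h2 a ha hb

theorem corner_setCorner (T : SetShYT lam) {s : Finset ℕ} (hs : s.Nonempty) (hs' : s ⊆ ones)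
    (h0 : (0, 0) ∈ lam.diagram) : (T.setCorner s hs hs').corner = s := by
  rw [corner, dif_pos h0]
  simp only [setCorner, if_true]
  rw [Finset.union_inter_distrib_right, Finset.sdiff_inter_self, Finset.empty_union,
    Finset.inter_eq_left.mpr hs']

theorem setCorner_setCorner (T : SetShYT lam) {s t : Finset ℕ} (hs : s.Nonempty) (hs' : s ⊆ ones)
    (ht : t.Nonempty) (ht' : t ⊆ ones) (hT : T.corner = s) :
    (T.setCorner t ht ht').setCorner s hs hs' = T := by
  have h0 : (0, 0) ∈ lam.diagram := mem_diagram_of_corner (hT ▸ hs)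
  ext1 p
  simp only [setCorner]
  split_ifs with hp
  · obtain ⟨p, hp'⟩ := p
    dsimp only at hp
    subst hp
    rw [corner, dif_pos h0] at hT
    rw [Finset.union_sdiff_distrib, Finset.sdiff_eq_empty_iff_subset.mpr ht', Finset.union_empty,
      Finset.sdiff_idem, ← hT, Finset.sdiff_union_inter]
  · rfl

theorem weight_setCorner (T : SetShYT lam) {s : Finset ℕ} (hs : s.Nonempty) (hs' : s ⊆ ones)
    (h0 : (0, 0) ∈ lam.diagram) :
    (T.setCorner s hs hs').weight + Finsupp.single 0 T.corner.card =
      T.weight + Finsupp.single 0 s.card := by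
  classical
  have hones : ∀ u : Finset ℕ, u ⊆ ones →
      ∑ a ∈ u, (Finsupp.single (varIndex a) 1 : ℕ →₀ ℕ) = Finsupp.single 0 u.card := by
    intro u hu
    rw [Finset.sum_congr rfl (g := fun _ => Finsupp.single 0 1), Finset.sum_const]
    · simp
    · intro a ha
      have h := mem_ones.mp (hu ha)
      rw [varIndex, Nat.div_eq_of_lt (by omega)]
  rw [weight, weight, Fintype.sum_eq_add_sum_compl ⟨_, h0⟩,
    Fintype.sum_eq_add_sum_compl (⟨_, h0⟩ : lam.diagram) fun p => ∑ a ∈ T.entry p, _]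
  have hrest : ∑ p ∈ {(⟨_, h0⟩ : lam.diagram)}ᶜ, ∑ a ∈ (T.setCorner s hs hs').entry p,
      (Finsupp.single (varIndex a) 1 : ℕ →₀ ℕ) =
      ∑ p ∈ {(⟨_, h0⟩ : lam.diagram)}ᶜ, ∑ a ∈ T.entry p, Finsupp.single (varIndex a) 1 := by
    refine Finset.sum_congr rfl fun p hp => ?_
    have hp' : p.1 ≠ (0, 0) := fun h => by
      refine Finset.mem_compl.mp hp (Finset.mem_singleton.mpr (Subtype.ext h))
    simp only [setCorner, if_neg hp']
  have hcor : ∑ a ∈ (T.setCorner s hs hs').entry ⟨_, h0⟩,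
      (Finsupp.single (varIndex a) 1 : ℕ →₀ ℕ) =
      ∑ a ∈ T.entry ⟨_, h0⟩ \ ones, Finsupp.single (varIndex a) 1 + Finsupp.single 0 s.card := by
    simp only [setCorner, if_true]
    rw [Finset.sum_union, hones s hs']
    exact Finset.disjoint_of_subset_right hs' Finset.sdiff_disjoint
  have hcor' : ∑ a ∈ T.entry ⟨_, h0⟩, (Finsupp.single (varIndex a) 1 : ℕ →₀ ℕ) =
      ∑ a ∈ T.entry ⟨_, h0⟩ \ ones, Finsupp.single (varIndex a) 1 +
        Finsupp.single 0 T.corner.card := by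
    rw [← hones _ T.corner_subset, corner, dif_pos h0, ← Finset.sum_union
      (Finset.disjoint_of_subset_right Finset.inter_subset_right Finset.sdiff_disjoint),
      Finset.sdiff_union_inter]
  rw [hrest, hcor, hcor']
  abel

/-- The exponent of the first variable is at most `λ₁ + 1`: the entries `1'` and `1` lie in the
first row, and only the box on the diagonal may contain both. -/
theorem weight_zero_le (T : SetShYT lam) : T.weight 0 ≤ lam.part 0 + 1 := by
  classical
  rw [psum_weight_one, psum_weight]
  calc ∑ p, ((T.entry p).filter fun a => varIndex a < 1).card
      ≤ ∑ p : lam.diagram, ((if p.1.1 = 0 then 1 else 0) + (if p.1 = (0, 0) then 1 else 0)) := by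
        refine Finset.sum_le_sum fun p _ => ?_
        split_ifs with h1 h2 h2
        · refine (Finset.card_le_card (t := ones) fun a ha => ?_).trans (by simp [ones])
          have := (Finset.mem_filter.mp ha).2
          simp only [varIndex] at this
          exact mem_ones.mpr (by omega)
        · refine (Finset.card_le_card (t := {1}) fun a ha => ?_).trans (by simp)
          obtain ⟨ha, hv⟩ := Finset.mem_filter.mp ha
          have := T.one_le_of_ne_corner p h2 ha
          simp only [varIndex] at hv
          exact Finset.mem_singleton.mpr (by omega)
        · rw [h2] at h1
          exact absurd rfl h1
        · rw [Nat.add_zero, Nat.le_zero, Finset.card_eq_zero, Finset.filter_eq_empty_iff]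
          intro a ha hv
          have := T.two_mul_row_le p ha
          simp only [varIndex] at hv
          omega
    _ ≤ lam.part 0 + 1 := by
        rw [Finset.sum_add_distrib]
        refine add_le_add ?_ ?_
        · rw [Finset.sum_coe_sort lam.diagram fun p => if p.1 = 0 then 1 else 0,
            ← Finset.card_filter, StrictPartition.card_filter_diagram_row]
        · rw [Finset.sum_coe_sort lam.diagram fun p => if p = (0, 0) then 1 else 0,
            ← Finset.card_filter]
          exact (Finset.card_le_card (t := {(0, 0)}) fun p hp => by
            simpa using (Finset.mem_filter.mp hp).2).trans (by simp)

/-- Without an entry `1'` or `1` in the first box, there is none in any other box. -/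
theorem weight_zero_of_corner_eq_empty (T : SetShYT lam) (h : T.corner = ∅) : T.weight 0 = 0 := by
  rw [psum_weight_one, psum_weight]
  refine Finset.sum_eq_zero fun p _ => ?_
  rw [Finset.card_eq_zero, Finset.filter_eq_empty_iff]
  intro a ha hv
  simp only [varIndex] at hv
  have h0 := StrictPartition.diagram_corner (i := p.1.1) (j := p.1.2) p.2
  rw [corner, dif_pos h0] at h
  obtain ⟨b, hb⟩ := T.nonempty ⟨_, h0⟩
  have hba : b ≤ a := by
    have hrow := T.two_mul_row_le p ha
    by_cases hp : p.1 = (0, 0)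
    · have hpe : p = ⟨_, h0⟩ := Subtype.ext hp
      subst hpe
      exact absurd (Finset.mem_inter.mpr ⟨ha, mem_ones.mpr (by omega)⟩) (by simp [h])
    · have h1 : p.1.1 = 0 := by omega
      refine T.row_weak ⟨_, h0⟩ p h1.symm ?_ b hb a ha
      rcases Nat.eq_zero_or_pos p.1.2 with h2 | h2
      · exact absurd (Prod.ext h1 h2) hp
      · exact h2
  exact absurd (Finset.mem_inter.mpr ⟨hb, mem_ones.mpr (by omega)⟩) (by simp [h])

theorem corner_card_le_weight (T : SetShYT lam) : T.corner.card ≤ T.weight 0 := by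
  classical
  by_cases h0 : (0, 0) ∈ lam.diagram
  · rw [psum_weight_one, psum_weight, corner, dif_pos h0]
    refine le_trans (Finset.card_le_card fun a ha => ?_) (Finset.single_le_sum
      (f := fun p => ((T.entry p).filter fun a => varIndex a < 1).card)
      (fun _ _ => Nat.zero_le _) (Finset.mem_univ (⟨_, h0⟩ : lam.diagram)))
    obtain ⟨h1, h2⟩ := Finset.mem_inter.mp ha
    refine Finset.mem_filter.mpr ⟨h1, ?_⟩
    have := mem_ones.mp h2
    simp only [varIndex]
    omega
  · rw [corner, dif_neg h0]
    exact Nat.zero_le _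

end SetShYT

/-- The number of set-valued shifted tableaux of given shape and weight whose set of entries `1'`
and `1` in the first box of the diagonal is `s`. -/
def cornerCount (lam : StrictPartition) (s : Finset ℕ) (m : ℕ →₀ ℕ) : ℕ :=
  {T : SetShYT lam | T.weight = m ∧ T.corner = s}.ncard

theorem cornerCount_le {lam : StrictPartition} {s t : Finset ℕ} (hs : s.Nonempty) (hs' : s ⊆ ones)
    (ht : t.Nonempty) (ht' : t ⊆ ones) {m n : ℕ →₀ ℕ}
    (h : m + Finsupp.single 0 t.card = n + Finsupp.single 0 s.card) :
    cornerCount lam s m ≤ cornerCount lam t n := by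
  refine Set.ncard_le_ncard_of_injOn (fun T => T.setCorner t ht ht') ?_ ?_
    ((SetShYT.finite_weight_eq lam n).subset fun T hT => hT.1)
  · rintro T ⟨rfl, hT⟩
    have h0 : (0, 0) ∈ lam.diagram := SetShYT.mem_diagram_of_corner (hT ▸ hs)
    refine ⟨?_, T.corner_setCorner ht ht' h0⟩
    have := T.weight_setCorner ht ht' h0
    rw [hT, h] at this
    exact add_right_cancel this
  · rintro T ⟨-, hT⟩ U ⟨-, hU⟩ hTU
    rw [← T.setCorner_setCorner hs hs' ht ht' hT, ← U.setCorner_setCorner hs hs' ht ht' hU]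
    dsimp only at hTU
    rw [hTU]

theorem cornerCount_congr {lam : StrictPartition} {s t : Finset ℕ} (hs : s.Nonempty)
    (hs' : s ⊆ ones) (ht : t.Nonempty) (ht' : t ⊆ ones) {m n : ℕ →₀ ℕ}
    (h : m + Finsupp.single 0 t.card = n + Finsupp.single 0 s.card) :
    cornerCount lam s m = cornerCount lam t n :=
  le_antisymm (cornerCount_le hs hs' ht ht' h) (cornerCount_le ht ht' hs hs' h.symm)

theorem gqCount_eq_sum (lam : StrictPartition) (m : ℕ →₀ ℕ) :
    gqCount lam m = cornerCount lam ∅ m + cornerCount lam {0} m + cornerCount lam {1} m +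
      cornerCount lam {0, 1} m := by
  classical
  have hfin := SetShYT.finite_weight_eq lam m
  have hc : ∀ s, cornerCount lam s m = (hfin.toFinset.filter fun T => T.corner = s).card := by
    intro s
    rw [cornerCount, ← Set.ncard_coe_finset]
    congr 1
    ext T
    simp
  rw [gqCount, Set.ncard_eq_toFinset_card _ hfin, Finset.card_eq_sum_card_fiberwise
    (f := SetShYT.corner) (t := ones.powerset) fun T _ => by simpa using T.corner_subset]
  simp_rw [← hc]
  rw [show ones.powerset = {∅, {0}, {1}, {0, 1}} by decide]
  rw [Finset.sum_insert (by decide), Finset.sum_insert (by decide), Finset.sum_insert (by decide),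
    Finset.sum_singleton]
  ring

theorem cornerCount_eq_zero {lam : StrictPartition} {s : Finset ℕ} {m : ℕ →₀ ℕ}
    (h : m 0 < s.card) : cornerCount lam s m = 0 := by
  by_contra hne
  obtain ⟨T, rfl, rfl⟩ := Set.nonempty_of_ncard_ne_zero hne
  exact absurd T.corner_card_le_weight (not_le.mpr h)

theorem cornerCount_empty_eq_zero {lam : StrictPartition} {m : ℕ →₀ ℕ} (h : m 0 ≠ 0) :
    cornerCount lam ∅ m = 0 := by
  by_contra hne
  obtain ⟨T, rfl, hT⟩ := Set.nonempty_of_ncard_ne_zero hne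
  exact h (T.weight_zero_of_corner_eq_empty hT)

theorem le_degree_of_cornerCount_ne_zero {lam : StrictPartition} {s : Finset ℕ} {m : ℕ →₀ ℕ}
    (h : cornerCount lam s m ≠ 0) : lam.size ≤ m.degree := by
  obtain ⟨T, rfl, -⟩ := Set.nonempty_of_ncard_ne_zero h
  rw [T.degree_weight]
  exact T.size_le

/-! ### Infinite linear combinations of the functions `GQ` -/

/-- The finite set of strict partitions of size at most `d`. -/
def sizeLE (d : ℕ) : Finset StrictPartition := (StrictPartition.finite_size_le d).toFinset

@[simp]
theorem mem_sizeLE {d : ℕ} {lam : StrictPartition} : lam ∈ sizeLE d ↔ lam.size ≤ d := by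
  simp [sizeLE]

/-- The infinite linear combination `∑_λ c_λ GQ_λ`. -/
def gqSum (c : StrictPartition → Zbeta) : PS := formalSum fun lam => c lam • GQ lam

theorem coeff_gqSum_of_le (c : StrictPartition → Zbeta) {m : ℕ →₀ ℕ} {d : ℕ} (h : m.degree ≤ d) :
    coeff m (gqSum c) = ∑ lam ∈ sizeLE d, c lam * coeff m (GQ lam) := by
  change ∑ᶠ lam, coeff m (c lam • GQ lam) = _
  rw [finsum_eq_sum_of_support_subset (s := sizeLE d)]
  · rfl
  · intro lam hlam
    rw [Function.mem_support, MvPowerSeries.coeff_smul] at hlam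
    have := size_le_of_coeff_GQ_ne_zero (right_ne_zero_of_mul hlam)
    simp
    omega

theorem coeff_gqSum (c : StrictPartition → Zbeta) (m : ℕ →₀ ℕ) :
    coeff m (gqSum c) = ∑ lam ∈ sizeLE m.degree, c lam * coeff m (GQ lam) :=
  coeff_gqSum_of_le c le_rfl

theorem isFormalSum_gqSum (c : StrictPartition → Zbeta) :
    IsFormalSum (fun lam => c lam • GQ lam) (gqSum c) := by
  refine ⟨fun m => (StrictPartition.finite_size_le m.degree).subset fun lam hlam => ?_, rfl⟩
  exact size_le_of_coeff_GQ_ne_zero (right_ne_zero_of_mul hlam)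

theorem gqSum_add (c e : StrictPartition → Zbeta) : gqSum (c + e) = gqSum c + gqSum e := by
  refine MvPowerSeries.ext fun m => ?_
  simp only [map_add, coeff_gqSum, Pi.add_apply, add_mul, Finset.sum_add_distrib]

theorem gqSum_sub (c e : StrictPartition → Zbeta) : gqSum (c - e) = gqSum c - gqSum e := by
  refine MvPowerSeries.ext fun m => ?_
  simp only [map_sub, coeff_gqSum, Pi.sub_apply, sub_mul, Finset.sum_sub_distrib]

theorem gqSum_smul (a : Zbeta) (c : StrictPartition → Zbeta) : gqSum (a • c) = a • gqSum c := by
  refine MvPowerSeries.ext fun m => ?_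
  simp only [MvPowerSeries.coeff_smul, coeff_gqSum, Pi.smul_apply, smul_eq_mul, Finset.mul_sum,
    mul_assoc]

theorem gqSum_zero : gqSum 0 = 0 := by
  refine MvPowerSeries.ext fun m => ?_
  simp [coeff_gqSum]

theorem gqSum_eq_sum {c : StrictPartition → Zbeta} {s : Finset StrictPartition}
    (h : ∀ lam, c lam ≠ 0 → lam ∈ s) : gqSum c = ∑ lam ∈ s, c lam • GQ lam := by
  refine MvPowerSeries.ext fun m => ?_
  change ∑ᶠ lam, coeff m (c lam • GQ lam) = _
  rw [map_sum]
  refine finsum_eq_sum_of_support_subset _ fun lam hlam => h lam ?_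
  exact left_ne_zero_of_mul hlam

open Classical in
theorem gqSum_single (lam : StrictPartition) : gqSum (Pi.single lam 1) = GQ lam := by
  rw [gqSum_eq_sum (s := {lam})]
  · simp
  · intro nu h
    by_contra hne
    exact h (Pi.single_eq_of_ne (by simpa using hne) _)

/-- The leading monomial of a nonzero infinite linear combination of the functions `GQ`. -/
theorem exists_leading {c : StrictPartition → Zbeta} (hc : ∃ lam, c lam ≠ 0) :
    ∃ lam, c lam ≠ 0 ∧ coeff lam.expo (gqSum c) ≠ 0 ∧
      (∀ nu, c nu ≠ 0 → lam.size ≤ nu.size) ∧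
      ∀ m, coeff m (gqSum c) ≠ 0 → lam.size ≤ m.degree := by
  classical
  have hex : ∃ d, ∃ lam, c lam ≠ 0 ∧ lam.size = d := hc.imp' StrictPartition.size
    fun lam h => ⟨lam, h, rfl⟩
  set d := Nat.find hex with hd
  have hmin : ∀ nu, c nu ≠ 0 → d ≤ nu.size := fun nu h => Nat.find_min' hex ⟨nu, h, rfl⟩
  obtain ⟨lam₀, h₀, h₀'⟩ := Nat.find_spec hex
  obtain ⟨lam, hmem, hmax⟩ := ((sizeLE d).filter fun nu => c nu ≠ 0).exists_maximalFor
    (fun nu => psum nu.expo) ⟨lam₀, Finset.mem_filter.mpr ⟨mem_sizeLE.mpr h₀'.le, h₀⟩⟩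
  obtain ⟨hle, hne⟩ := Finset.mem_filter.mp hmem
  have hsize : lam.size = d := le_antisymm (mem_sizeLE.mp hle) (hmin lam hne)
  refine ⟨lam, hne, ?_, fun nu h => hsize ▸ hmin nu h, fun m hm => ?_⟩
  · rw [coeff_gqSum, Finset.sum_eq_single lam]
    · exact mul_ne_zero hne (coeff_expo_GQ_ne_zero lam)
    · intro nu hnu hnl
      rw [mem_sizeLE, StrictPartition.degree_expo, hsize] at hnu
      by_contra h
      have hnu0 := left_ne_zero_of_mul h
      have hs : nu.size = d := le_antisymm hnu (hmin nu hnu0)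
      have hp := psum_le_of_coeff_GQ_ne_zero (right_ne_zero_of_mul h)
        (by rw [StrictPartition.degree_expo, hsize, hs])
      have hp' := hmax (Finset.mem_coe.mpr (Finset.mem_filter.mpr ⟨mem_sizeLE.mpr hnu, hnu0⟩)) hp
      exact hnl (StrictPartition.expo_injective (psum_injective (le_antisymm hp' hp)))
    · intro h
      exact absurd (mem_sizeLE.mpr (by rw [StrictPartition.degree_expo])) h
  · rw [coeff_gqSum] at hm
    obtain ⟨nu, hnu, h⟩ := Finset.exists_ne_zero_of_sum_ne_zero hm
    rw [hsize]
    exact (hmin nu (left_ne_zero_of_mul h)).trans (mem_sizeLE.mp hnu)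

/-- The coefficients of an infinite linear combination of the functions `GQ` are determined, up to
size `d`, by the coefficients of degree at most `d` of the power series. -/
theorem eq_of_coeff_gqSum_eq {c e : StrictPartition → Zbeta} {d : ℕ}
    (h : ∀ m : ℕ →₀ ℕ, m.degree ≤ d → coeff m (gqSum c) = coeff m (gqSum e))
    {lam : StrictPartition} (hlam : lam.size ≤ d) : c lam = e lam := by
  by_contra hne
  have hne' : (c - e) lam ≠ 0 := sub_ne_zero.mpr hne
  obtain ⟨nu, -, h1, h2, -⟩ := exists_leading ⟨lam, hne'⟩
  refine h1 ?_
  rw [gqSum_sub, map_sub, sub_eq_zero]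
  exact h _ (by rw [StrictPartition.degree_expo]; exact (h2 lam hne').trans hlam)

theorem gqSum_injective : Function.Injective gqSum := fun c e h =>
  funext fun lam => eq_of_coeff_gqSum_eq (d := lam.size) (fun m _ => by rw [h]) le_rfl

/-! ### Bounding the first part -/

/-- The polynomial `x₀ ⊕ x₀ = 2 x₀ + β x₀²`. -/
def doubleVar : PS := monomial (Finsupp.single 0 1) 2 + monomial (Finsupp.single 0 2) beta

/-- The power series that become independent of `x₀` modulo `x₀ ⊕ x₀`. -/
def doubleVarSubalgebra : Subalgebra Zbeta PS where
  carrier := {f | ∃ f₀ h : PS, (∀ m, coeff m f₀ ≠ 0 → m 0 = 0) ∧ f = f₀ + doubleVar * h}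
  mul_mem' := by
    classical
    rintro _ _ ⟨f, h, hf, rfl⟩ ⟨g, k, hg, rfl⟩
    refine ⟨f * g, f * k + h * g + doubleVar * h * k, fun m hm => ?_, by ring⟩
    rw [MvPowerSeries.coeff_mul] at hm
    obtain ⟨p, hp, hne⟩ := Finset.exists_ne_zero_of_sum_ne_zero hm
    rw [← Finset.HasAntidiagonal.mem_antidiagonal.mp hp, Finsupp.add_apply, hf _ (left_ne_zero_of_mul hne),
      hg _ (right_ne_zero_of_mul hne)]
  add_mem' := by
    rintro _ _ ⟨f, h, hf, rfl⟩ ⟨g, k, hg, rfl⟩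
    refine ⟨f + g, h + k, fun m hm => ?_, by ring⟩
    by_contra h0
    refine hm ?_
    rw [map_add, of_not_not (mt (hf m) h0), of_not_not (mt (hg m) h0), add_zero]
  algebraMap_mem' r := by
    classical
    refine ⟨algebraMap _ _ r, 0, fun m hm => ?_, by simp⟩
    rw [MvPowerSeries.algebraMap_apply, MvPowerSeries.coeff_C] at hm
    by_contra h0
    refine hm (if_neg fun h => h0 ?_)
    simp [h]

theorem GQ_mem_doubleVarSubalgebra (lam : StrictPartition) : GQ lam ∈ doubleVarSubalgebra := by
  classical
  obtain ⟨f, hf⟩ : ∃ f : PS, ∀ m, coeff m f =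
      (cornerCount lam ∅ m : Zbeta) * beta ^ (m.degree - lam.size) := ⟨_, fun _ => rfl⟩
  obtain ⟨h, hh⟩ : ∃ h : PS, ∀ n, coeff n h =
      (cornerCount lam {1} (n + Finsupp.single 0 1) : Zbeta) *
        beta ^ (n.degree + 1 - lam.size) := ⟨_, fun _ => rfl⟩
  refine ⟨f, h, fun m hm => ?_, MvPowerSeries.ext fun m => ?_⟩
  · by_contra h0
    refine hm ?_
    rw [hf, cornerCount_empty_eq_zero h0]
    simp
  · rw [coeff_GQ, gqCount_eq_sum, map_add, doubleVar, add_mul, map_add,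
      MvPowerSeries.coeff_monomial_mul, MvPowerSeries.coeff_monomial_mul]
    simp only [hf, hh, Finsupp.single_le_iff]
    have h01 : cornerCount lam {0} m = cornerCount lam {1} m :=
      cornerCount_congr (by simp) (by simp [ones]) (by simp) (by simp [ones]) (by simp)
    have h1 : (if 1 ≤ m 0 then 2 * ((cornerCount lam {1} (m - Finsupp.single 0 1 +
          Finsupp.single 0 1) : Zbeta) *
          beta ^ ((m - Finsupp.single 0 1).degree + 1 - lam.size)) else 0) =
        2 * ((cornerCount lam {1} m : Zbeta) * beta ^ (m.degree - lam.size)) := by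
      split_ifs with h
      · have hm : m - Finsupp.single 0 1 + Finsupp.single 0 1 = m :=
          tsub_add_cancel_of_le (Finsupp.single_le_iff.mpr h)
        have hd : (m - Finsupp.single 0 1).degree + 1 = m.degree := by
          conv_rhs => rw [← hm]
          simp [Finsupp.degree_single]
        rw [hm, hd]
      · rw [cornerCount_eq_zero (by simpa using h)]
        simp
    have h2 : (if 2 ≤ m 0 then beta * ((cornerCount lam {1} (m - Finsupp.single 0 2 +
          Finsupp.single 0 1) : Zbeta) *
          beta ^ ((m - Finsupp.single 0 2).degree + 1 - lam.size)) else 0) =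
        (cornerCount lam {0, 1} m : Zbeta) * beta ^ (m.degree - lam.size) := by
      split_ifs with h
      · have hm : m - Finsupp.single 0 2 + Finsupp.single 0 2 = m :=
          tsub_add_cancel_of_le (Finsupp.single_le_iff.mpr h)
        have hd : (m - Finsupp.single 0 2).degree + 2 = m.degree := by
          conv_rhs => rw [← hm]
          simp [Finsupp.degree_single]
        have hc : cornerCount lam {1} (m - Finsupp.single 0 2 + Finsupp.single 0 1) =
            cornerCount lam {0, 1} m := by
          refine cornerCount_congr (by simp) (by simp [ones]) (by simp) (by simp [ones]) ?_
          rw [Finset.card_singleton, Finset.card_pair (by decide), add_right_comm, hm]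
        by_cases h0 : cornerCount lam {1} (m - Finsupp.single 0 2 + Finsupp.single 0 1) = 0
        · rw [← hc, h0]
          simp
        · have hs := le_degree_of_cornerCount_ne_zero h0
          rw [map_add, Finsupp.degree_single] at hs
          rw [hc, mul_left_comm, ← pow_succ']
          congr 2
          omega
      · rw [cornerCount_eq_zero (by
          rw [Finset.card_pair (by decide)]
          omega)]
        simp
    rw [h1, h2, h01]
    push_cast
    ring

/-- The power series whose degree in `x₀` is at most `N`. -/
def DegreeLE (N : ℕ) (f : PS) : Prop := ∀ m, coeff m f ≠ 0 → m 0 ≤ N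

theorem degreeLE_GQ (lam : StrictPartition) : DegreeLE (lam.part 0 + 1) (GQ lam) := by
  intro m hm
  obtain ⟨T, rfl⟩ := exists_of_coeff_GQ_ne_zero hm
  exact T.weight_zero_le

theorem DegreeLE.mul {M N : ℕ} {f g : PS} (hf : DegreeLE M f) (hg : DegreeLE N g) :
    DegreeLE (M + N) (f * g) := by
  classical
  intro m hm
  rw [MvPowerSeries.coeff_mul] at hm
  obtain ⟨p, hp, hne⟩ := Finset.exists_ne_zero_of_sum_ne_zero hm
  rw [← Finset.HasAntidiagonal.mem_antidiagonal.mp hp, Finsupp.add_apply]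
  exact add_le_add (hf _ (left_ne_zero_of_mul hne)) (hg _ (right_ne_zero_of_mul hne))

/-- A polynomial that stays divisible by `2ⁱ` when multiplied by `βⁱ`, for all `i`, vanishes. -/
theorem eq_zero_of_two_pow_dvd {h : Zbeta} (hd : ∀ i, (2 : Zbeta) ^ i ∣ (-beta) ^ i * h) :
    h = 0 := by
  ext n
  have hn : ∀ i, (2 : ℤ) ^ i ∣ h.coeff n := by
    intro i
    obtain ⟨q, hq⟩ := hd i
    have h1 : (beta ^ i * h).coeff (n + i) = h.coeff n := by
      rw [beta, Polynomial.coeff_X_pow_mul]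
    have h2 : beta ^ i * h = Polynomial.C ((2 : ℤ) ^ i) * ((-1) ^ i * q) := by
      rw [neg_pow] at hq
      have hu : ((-1 : Zbeta) ^ i) * (-1) ^ i = 1 := by rw [← mul_pow]; simp
      have : Polynomial.C ((2 : ℤ) ^ i) = (2 : Zbeta) ^ i := by simp
      rw [this]
      calc beta ^ i * h = (-1) ^ i * ((-1) ^ i * beta ^ i * h) := by
            rw [← mul_assoc, ← mul_assoc, hu, one_mul]
        _ = _ := by rw [hq]; ring
    rw [← h1, h2, Polynomial.coeff_C_mul]
    exact Dvd.intro _ rfl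
  rw [Polynomial.coeff_zero]
  refine Int.eq_zero_of_abs_lt_dvd (hn (h.coeff n).natAbs) ?_
  rw [Int.abs_eq_natAbs]
  exact_mod_cast Nat.lt_two_pow_self

/-- A power series that becomes independent of `x₀` modulo `x₀ ⊕ x₀`, and has degree at most `N`
in `x₀`, does not have a monomial of lowest degree that is divisible by `x₀ᴺ`. -/
theorem false_of_leading {P : PS} (hP : P ∈ doubleVarSubalgebra) {N : ℕ} (hN : 0 < N)
    (hdeg : DegreeLE N P) {k : ℕ →₀ ℕ} (hk : coeff k P ≠ 0) (hkN : N ≤ k 0)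
    (hlow : ∀ m, coeff m P ≠ 0 → k.degree ≤ m.degree) : False := by
  classical
  obtain ⟨f, h, hf, rfl⟩ := hP
  have hk0 : k 0 = N := le_antisymm (hdeg k hk) hkN
  obtain ⟨j, rfl⟩ : ∃ j, N = j + 1 := ⟨N - 1, by omega⟩
  set g := k.erase 0 with hg
  have hkg : k = g + Finsupp.single 0 (j + 1) := by
    rw [hg, ← hk0, add_comm, Finsupp.single_add_erase]
  have hg0 : g 0 = 0 := by simp [hg]
  -- The coefficients of the series in `x₀` that multiply the rest of the leading monomial.
  let p : ℕ → Zbeta := fun i => coeff (g + Finsupp.single 0 i) (f + doubleVar * h)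
  let q : ℕ → Zbeta := fun i => coeff (g + Finsupp.single 0 i) h
  have hp1 : p 1 = 2 * q 0 := by
    have h1 : coeff (g + Finsupp.single 0 1) f = 0 := by
      by_contra hne
      have := hf _ hne
      simp [hg0] at this
    simp only [p, q, map_add, h1, doubleVar, add_mul, MvPowerSeries.coeff_monomial_mul,
      Finsupp.single_le_iff]
    simp [hg0]
  have hp2 : ∀ i, p (i + 2) = 2 * q (i + 1) + beta * q i := by
    intro i
    have h1 : coeff (g + Finsupp.single 0 (i + 2)) f = 0 := by
      by_contra hne
      have := hf _ hne
      simp [hg0] at this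
    have e1 : g + Finsupp.single 0 (i + 2) =
        Finsupp.single 0 1 + (g + Finsupp.single 0 (i + 1)) := by
      rw [add_left_comm, ← Finsupp.single_add]
      congr 2
      omega
    have e2 : g + Finsupp.single 0 (i + 2) = Finsupp.single 0 2 + (g + Finsupp.single 0 i) := by
      rw [add_left_comm, ← Finsupp.single_add]
      congr 2
      omega
    simp only [p, q, map_add, h1, doubleVar, add_mul, zero_add]
    congr 1
    · rw [e1, MvPowerSeries.coeff_add_monomial_mul]
    · rw [e2, MvPowerSeries.coeff_add_monomial_mul]
  have hp0 : ∀ i, i ≠ j + 1 → p i = 0 := by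
    intro i hi
    by_contra hne
    have h1 := hdeg _ hne
    have h2 := hlow _ hne
    rw [hkg, map_add, map_add, Finsupp.degree_single, Finsupp.degree_single] at h2
    rw [Finsupp.add_apply, hg0, Finsupp.single_eq_same] at h1
    omega
  have hpj : p (j + 1) ≠ 0 := by
    simp only [p, ← hkg]
    exact hk
  have h2 : (2 : Zbeta) ≠ 0 := two_ne_zero
  have hq0 : ∀ i, i < j → q i = 0 := by
    intro i
    induction i with
    | zero =>
      intro hij
      have := hp0 1 (by omega)
      rw [hp1] at this
      exact (mul_eq_zero.mp this).resolve_left h2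
    | succ i ih =>
      intro hij
      have := hp0 (i + 2) (by omega)
      rw [hp2, ih (by omega), mul_zero, add_zero] at this
      exact (mul_eq_zero.mp this).resolve_left h2
  have hpq : p (j + 1) = 2 * q j := by
    rcases j with _ | j
    · exact hp1
    · rw [hp2, hq0 j (by omega), mul_zero, add_zero]
  have hrec : ∀ i, 2 ^ i * q (j + i) = (-beta) ^ i * q j := by
    intro i
    induction i with
    | zero => simp
    | succ i ih =>
      have := hp0 (j + i + 2) (by omega)
      rw [hp2] at this
      have h3 : 2 * q (j + i + 1) = -beta * q (j + i) := by linear_combination this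
      calc 2 ^ (i + 1) * q (j + (i + 1)) = 2 ^ i * (2 * q (j + i + 1)) := by
            rw [pow_succ, mul_assoc, add_assoc]
        _ = -beta * (2 ^ i * q (j + i)) := by rw [h3]; ring
        _ = _ := by rw [ih]; ring
  refine hpj ?_
  rw [hpq, eq_zero_of_two_pow_dvd fun i => ⟨_, (hrec i).symm⟩, mul_zero]

/-- An expansion into functions `GQ_λ` of a power series of degree at most `N` in `x₀` only
involves strict partitions with `λ₁ < N`, provided that the power series becomes independent of
`x₀` modulo `x₀ ⊕ x₀`. -/
theorem part_zero_lt_of_gqSum {c : StrictPartition → Zbeta} {N : ℕ} (hN : 0 < N)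
    (hc : gqSum c ∈ doubleVarSubalgebra) (hdeg : DegreeLE N (gqSum c)) {lam : StrictPartition}
    (hlam : c lam ≠ 0) : lam.part 0 < N := by
  classical
  by_contra hge
  let s : Finset StrictPartition := (StrictPartition.finite_part_zero_le (N - 1)).toFinset
  have hs : ∀ nu, nu ∈ s ↔ nu.part 0 < N := by
    intro nu
    simp only [s, Set.Finite.mem_toFinset]
    change nu.part 0 ≤ N - 1 ↔ _
    omega
  let c₁ : StrictPartition → Zbeta := fun nu => if nu ∈ s then c nu else 0
  have hc₁ : gqSum c₁ = ∑ nu ∈ s, c₁ nu • GQ nu := gqSum_eq_sum fun nu h => by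
    by_contra hns
    exact h (if_neg hns)
  have hmem : gqSum (c - c₁) ∈ doubleVarSubalgebra := by
    rw [gqSum_sub, hc₁]
    exact sub_mem hc (sum_mem fun nu _ =>
      Subalgebra.smul_mem _ (GQ_mem_doubleVarSubalgebra nu) _)
  have hdeg' : DegreeLE N (gqSum (c - c₁)) := by
    intro m hm
    by_contra hlt
    refine hm ?_
    rw [gqSum_sub, map_sub, of_not_not (mt (hdeg m) hlt), hc₁, map_sum, Finset.sum_eq_zero,
      sub_zero]
    intro nu hnu
    have h1 : coeff m (GQ nu) = 0 := by
      by_contra hne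
      have h2 := degreeLE_GQ nu m hne
      have h3 := (hs nu).mp hnu
      omega
    rw [MvPowerSeries.coeff_smul, h1, mul_zero]
  have hne : (c - c₁) lam ≠ 0 := by
    have : lam ∉ s := fun h => hge ((hs lam).mp h)
    simpa [c₁, this] using hlam
  obtain ⟨nu, h1, h2, -, h3⟩ := exists_leading ⟨lam, hne⟩
  refine false_of_leading hmem hN hdeg' h2 ?_ fun m hm => ?_
  · by_contra hlt
    have : nu ∈ s := (hs nu).mpr (not_le.mp hlt)
    simp [c₁, this] at h1
  · rw [StrictPartition.degree_expo]
    exact h3 m hm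

/-! ### Schur functions and the operator `ω` -/

/-- The exponent vector of the monomial attached to a Young diagram. -/
def youngExpo (mu : YoungDiagram) : ℕ →₀ ℕ :=
  Finsupp.onFinset (Finset.range (mu.colLen 0)) mu.rowLen fun i hi => by
    rw [Finset.mem_range, ← YoungDiagram.mem_iff_lt_colLen, YoungDiagram.mem_iff_lt_rowLen]
    exact Nat.pos_of_ne_zero hi

@[simp]
theorem youngExpo_apply (mu : YoungDiagram) (i : ℕ) : youngExpo mu i = mu.rowLen i := rfl

theorem youngExpo_injective : Function.Injective youngExpo := by
  intro mu nu h
  refine SetLike.ext fun ⟨i, j⟩ => ?_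
  rw [YoungDiagram.mem_iff_lt_rowLen, YoungDiagram.mem_iff_lt_rowLen, ← youngExpo_apply, h,
    youngExpo_apply]

theorem psum_youngExpo (mu : YoungDiagram) (k : ℕ) :
    psum (youngExpo mu) k = (mu.cells.filter fun p => p.1 < k).card := by
  rw [Finset.card_eq_sum_card_fiberwise (f := Prod.fst) (t := Finset.range k)
    (fun p hp => by simpa using (Finset.mem_filter.mp hp).2)]
  refine Finset.sum_congr rfl fun i hi => ?_
  rw [Finset.filter_filter, youngExpo_apply, YoungDiagram.rowLen_eq_card, YoungDiagram.row]
  congr 1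
  ext p
  simp only [Finset.mem_filter, Finset.mem_range] at hi ⊢
  constructor
  · rintro ⟨h1, h2⟩
    exact ⟨h1, by omega, h2⟩
  · rintro ⟨h1, -, h2⟩
    exact ⟨h1, h2⟩

theorem degree_youngExpo (mu : YoungDiagram) : (youngExpo mu).degree = mu.cells.card := by
  refine le_antisymm ?_ ?_
  · obtain ⟨k, hk⟩ := exists_psum_eq_degree (youngExpo mu)
    rw [← hk, psum_youngExpo]
    exact Finset.card_filter_le _ _
  · refine le_trans ?_ (psum_le_degree _ (mu.colLen 0))
    rw [psum_youngExpo, Finset.filter_true_of_mem]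
    rintro ⟨i, j⟩ hp
    exact YoungDiagram.mem_iff_lt_colLen.mp (mu.up_left_mem le_rfl (Nat.zero_le j) hp)

theorem finite_card_cells_eq (n : ℕ) : {mu : YoungDiagram | mu.cells.card = n}.Finite := by
  refine Set.Finite.of_finite_image (f := YoungDiagram.cells)
    ((Finset.range n ×ˢ Finset.range n).powerset.finite_toSet.subset ?_)
    fun mu _ nu _ h => YoungDiagram.ext h
  rintro _ ⟨mu, rfl, rfl⟩
  refine Finset.mem_coe.mpr (Finset.mem_powerset.mpr ?_)
  rintro ⟨i, j⟩ hp
  rw [Finset.mem_product, Finset.mem_range, Finset.mem_range]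
  constructor
  · have h1 := YoungDiagram.mem_iff_lt_colLen.mp hp
    rw [YoungDiagram.colLen_eq_card] at h1
    exact h1.trans_le (Finset.card_filter_le _ _)
  · have h1 := YoungDiagram.mem_iff_lt_rowLen.mp hp
    rw [YoungDiagram.rowLen_eq_card] at h1
    exact h1.trans_le (Finset.card_filter_le _ _)

/-- The finite set of Young diagrams with `n` cells. -/
def youngOfCard (n : ℕ) : Finset YoungDiagram := (finite_card_cells_eq n).toFinset

@[simp]
theorem mem_youngOfCard {n : ℕ} {mu : YoungDiagram} : mu ∈ youngOfCard n ↔ mu.cells.card = n := by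
  simp [youngOfCard]

theorem le_entry {mu : YoungDiagram} (T : SemistandardYoungTableau mu) {i j : ℕ}
    (h : (i, j) ∈ mu) : i ≤ T i j := by
  induction i with
  | zero => exact Nat.zero_le _
  | succ i ih =>
    have h1 := ih (mu.up_left_mem (Nat.le_succ i) le_rfl h)
    have h2 := T.col_strict (Nat.lt_add_one i) h
    omega

theorem psum_ssytWeight {mu : YoungDiagram} (T : SemistandardYoungTableau mu) (k : ℕ) :
    psum (ssytWeight T) k = (mu.cells.filter fun p => T p.1 p.2 < k).card := by
  rw [ssytWeight, psum_sum, Finset.card_filter]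
  exact Finset.sum_congr rfl fun p _ => psum_single _ _

theorem psum_ssytWeight_le {mu : YoungDiagram} (T : SemistandardYoungTableau mu) :
    psum (ssytWeight T) ≤ psum (youngExpo mu) := by
  intro k
  rw [psum_ssytWeight, psum_youngExpo]
  refine Finset.card_le_card fun p hp => ?_
  obtain ⟨h1, h2⟩ := Finset.mem_filter.mp hp
  exact Finset.mem_filter.mpr ⟨h1, (le_entry T h1).trans_lt h2⟩

theorem degree_ssytWeight {mu : YoungDiagram} (T : SemistandardYoungTableau mu) :
    (ssytWeight T).degree = mu.cells.card := by
  simp [ssytWeight, Finsupp.degree_single]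

theorem ssytWeight_eq_iff {mu : YoungDiagram} (T : SemistandardYoungTableau mu) :
    ssytWeight T = youngExpo mu ↔ T = SemistandardYoungTableau.highestWeight mu := by
  constructor
  · intro h
    ext i j
    rw [SemistandardYoungTableau.highestWeight_apply]
    split_ifs with hp
    · refine le_antisymm ?_ (le_entry T hp)
      have h1 := congrArg (fun m => psum m (i + 1)) h
      simp only [psum_ssytWeight, psum_youngExpo] at h1
      have h2 : (mu.cells.filter fun p => T p.1 p.2 < i + 1) =
          mu.cells.filter fun p => p.1 < i + 1 := by
        refine Finset.eq_of_subset_of_card_le (fun p hp => ?_) h1.ge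
        obtain ⟨h1, h2⟩ := Finset.mem_filter.mp hp
        exact Finset.mem_filter.mpr ⟨h1, (le_entry T h1).trans_lt h2⟩
      have h3 : (i, j) ∈ mu.cells.filter fun p => T p.1 p.2 < i + 1 := by
        rw [h2]
        exact Finset.mem_filter.mpr ⟨hp, Nat.lt_succ_self i⟩
      exact Nat.lt_succ_iff.mp (Finset.mem_filter.mp h3).2
    · exact T.zeros hp
  · rintro rfl
    apply psum_injective
    funext k
    rw [psum_ssytWeight, psum_youngExpo]
    congr 1
    refine Finset.filter_congr fun p hp => ?_
    rw [SemistandardYoungTableau.highestWeight_apply, if_pos ((YoungDiagram.mem_cells _).mp hp)]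

theorem exists_of_coeff_schur_ne_zero {mu : YoungDiagram} {m : ℕ →₀ ℕ}
    (h : coeff m (schur mu) ≠ 0) : ∃ T : SemistandardYoungTableau mu, ssytWeight T = m := by
  by_contra hT
  push Not at hT
  exact h (finsum_eq_zero_of_forall_eq_zero fun T =>
    MvPowerSeries.coeff_monomial_ne (hT T).symm _)

theorem degree_of_coeff_schur_ne_zero {mu : YoungDiagram} {m : ℕ →₀ ℕ}
    (h : coeff m (schur mu) ≠ 0) : mu.cells.card = m.degree := by
  obtain ⟨T, rfl⟩ := exists_of_coeff_schur_ne_zero h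
  exact (degree_ssytWeight T).symm

theorem coeff_youngExpo_schur (mu : YoungDiagram) : coeff (youngExpo mu) (schur mu) = 1 := by
  change ∑ᶠ T : SemistandardYoungTableau mu,
      coeff (youngExpo mu) (monomial (ssytWeight T) (1 : Zbeta)) = 1
  rw [finsum_eq_single _ (SemistandardYoungTableau.highestWeight mu)]
  · rw [(ssytWeight_eq_iff _).mpr rfl, MvPowerSeries.coeff_monomial_same]
  · intro T hT
    exact MvPowerSeries.coeff_monomial_ne (fun h => hT ((ssytWeight_eq_iff T).mp h.symm)) _

theorem card_cells_transpose (mu : YoungDiagram) : mu.transpose.cells.card = mu.cells.card := by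
  rw [YoungDiagram.transpose]
  exact Finset.card_map _

/-- The linear functionals on power series that are finite linear combinations of coefficients. -/
def coeffSpan : Submodule Zbeta (PS →ₗ[Zbeta] Zbeta) :=
  Submodule.span Zbeta (Set.range fun m : ℕ →₀ ℕ => coeff m)

theorem coeff_mem_coeffSpan (m : ℕ →₀ ℕ) : coeff m ∈ coeffSpan :=
  Submodule.subset_span ⟨m, rfl⟩

theorem coeff_of_isSchurExpansion {f : PS} {c : YoungDiagram → Zbeta} (h : IsSchurExpansion f c)
    (m : ℕ →₀ ℕ) : coeff m f = ∑ mu ∈ youngOfCard m.degree, c mu * coeff m (schur mu) := by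
  rw [h.2]
  change ∑ᶠ mu, coeff m (c mu • schur mu) = _
  refine finsum_eq_sum_of_support_subset _ fun mu hmu => ?_
  simpa using degree_of_coeff_schur_ne_zero (right_ne_zero_of_mul hmu)

/-- The coefficients of a Schur expansion are finite linear combinations of the coefficients of the
power series, since the Kostka numbers are unitriangular. -/
theorem exists_schur_functional (eta : YoungDiagram) :
    ∃ θ ∈ coeffSpan, ∀ f c, IsSchurExpansion f c → θ f = c eta := by
  classical
  obtain ⟨l, hl⟩ := exists_left_inverse_of_dominance
    (ι := {mu // mu ∈ youngOfCard eta.cells.card}) (fun mu => youngExpo mu.1)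
    (fun a b h => Subtype.ext (youngExpo_injective h))
    (fun a b => coeff (youngExpo a.1) (schur b.1)) (fun a => coeff_youngExpo_schur a.1)
    (fun a b h => by
      obtain ⟨T, hT⟩ := exists_of_coeff_schur_ne_zero h
      rw [← hT]
      exact psum_ssytWeight_le T) ⟨eta, by simp⟩
  refine ⟨∑ a, l a • coeff (youngExpo a.1), Submodule.sum_mem _ fun a _ =>
    Submodule.smul_mem _ _ (coeff_mem_coeffSpan _), fun f c h => ?_⟩
  have hcoeff : ∀ a : {mu // mu ∈ youngOfCard eta.cells.card}, coeff (youngExpo a.1) f =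
      ∑ b : {mu // mu ∈ youngOfCard eta.cells.card},
        c b.1 * coeff (youngExpo a.1) (schur b.1) := by
    intro a
    rw [coeff_of_isSchurExpansion h, degree_youngExpo, mem_youngOfCard.mp a.2,
      ← Finset.sum_coe_sort]
  simp only [LinearMap.sum_apply, LinearMap.smul_apply, smul_eq_mul, hcoeff, Finset.mul_sum]
  rw [Finset.sum_comm]
  calc _ = ∑ b : {mu // mu ∈ youngOfCard eta.cells.card}, c b.1 *
        ∑ a, l a * coeff (youngExpo a.1) (schur b.1) := by
        refine Finset.sum_congr rfl fun b _ => ?_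
        rw [Finset.mul_sum]
        exact Finset.sum_congr rfl fun a _ => by ring
    _ = c eta := by
        simp only [hl]
        rw [Finset.sum_eq_single ⟨eta, by simp⟩]
        · simp
        · intro b _ hb
          rw [if_neg (Ne.symm hb), mul_zero]
        · simp

/-- On the power series that have a Schur expansion, the coefficients of `ω(f)` are finite linear
combinations of those of `f`. -/
theorem exists_omega_functional (m : ℕ →₀ ℕ) :
    ∃ θ ∈ coeffSpan, ∀ f, (∃ c, IsSchurExpansion f c) → coeff m (omega f) = θ f := by
  choose θ hθ hθ' using exists_schur_functional
  refine ⟨∑ mu ∈ youngOfCard m.degree, coeff m (schur mu.transpose) • θ mu,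
    Submodule.sum_mem _ fun mu _ => Submodule.smul_mem _ _ (hθ mu), fun f hf => ?_⟩
  rw [omega, dif_pos hf]
  change ∑ᶠ mu, coeff m (hf.choose mu • schur mu.transpose) = _
  rw [finsum_eq_sum_of_support_subset (s := youngOfCard m.degree)]
  · simp only [LinearMap.sum_apply, LinearMap.smul_apply, smul_eq_mul]
    refine Finset.sum_congr rfl fun mu _ => ?_
    rw [hθ' mu f _ hf.choose_spec, MvPowerSeries.coeff_smul, mul_comm]
  · intro mu hmu
    have := degree_of_coeff_schur_ne_zero (right_ne_zero_of_mul hmu)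
    rw [card_cells_transpose] at this
    simpa using this

theorem omega_zero : omega 0 = 0 := by
  refine MvPowerSeries.ext fun m => ?_
  obtain ⟨θ, -, h⟩ := exists_omega_functional m
  rw [h 0 ⟨0, by simp, ?_⟩]
  · simp
  · refine MvPowerSeries.ext fun n => ?_
    change _ = ∑ᶠ mu, coeff n ((0 : YoungDiagram → Zbeta) mu • schur mu)
    simp

/-! ### Shifted bar tableaux -/

theorem finpartition_eq_bot {α : Type*} [Fintype α] [DecidableEq α]
    (P : Finpartition (Finset.univ : Finset α)) (h : ∀ p q, P.part p = P.part q → p = q) :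
    P = ⊥ := by
  have hpart : ∀ p, P.part p = {p} := by
    intro p
    refine Finset.eq_singleton_iff_unique_mem.mpr
      ⟨P.mem_part (Finset.mem_univ p), fun q hq => ?_⟩
    refine h q p ?_
    exact P.part_eq_of_mem (P.part_mem.mpr (Finset.mem_univ p)) hq
  refine Finpartition.ext (Finset.ext fun B => ?_)
  rw [Finpartition.mem_bot_iff]
  constructor
  · intro hB
    obtain ⟨p, hp⟩ := P.nonempty_of_mem_parts hB
    refine ⟨p, Finset.mem_univ p, ?_⟩
    rw [← hpart p, P.part_eq_of_mem hB hp]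
  · rintro ⟨p, hp, rfl⟩
    rw [← hpart p]
    exact P.part_mem.mpr hp

namespace ShBTP

theorem ext_entry_blocks {lam mu : StrictPartition} {T U : ShBTP lam mu}
    (h1 : ∀ p, T.entry p = U.entry p) (h2 : T.blocks = U.blocks) : T = U := by
  cases T
  cases U
  obtain rfl := funext h1
  dsimp only at h2
  subst h2
  rfl

variable {lam : StrictPartition}

theorem mem_diagram (p : lam.skewDiagram .empty) : p.1 ∈ lam.diagram :=
  (Finset.ext_iff.mp (StrictPartition.skewDiagram_empty lam) p.1).mp p.2

theorem mem_skewDiagram {p : ℕ × ℕ} (hp : p ∈ lam.diagram) : p ∈ lam.skewDiagram .empty := by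
  rwa [StrictPartition.skewDiagram_empty]

theorem row_le_varIndex (T : ShBTP lam .empty) (p : lam.skewDiagram .empty) :
    p.1.1 ≤ varIndex (T.entry p) := by
  have hF : ShiftedFilling lam.diagram
      fun p => {a | ∃ h : p ∈ lam.skewDiagram .empty, a = T.entry ⟨p, h⟩} :=
    { nonempty := fun p hp => ⟨_, mem_skewDiagram hp, rfl⟩
      row_weak := fun _ _ _ _ h1 h2 _ ⟨_, ha⟩ _ ⟨_, hb⟩ => by
        rw [ha, hb]
        exact T.row_weak _ _ h1 h2
      col_weak := fun _ _ _ _ h1 h2 _ ⟨_, ha⟩ _ ⟨_, hb⟩ => by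
        rw [ha, hb]
        exact T.col_weak _ _ h1 h2
      col_unprimed := fun _ _ _ _ h1 h2 _ ⟨_, ha⟩ ⟨_, hb⟩ => by
        rw [ha]
        exact T.col_unprimed _ _ h1 h2 (ha.symm.trans hb)
      row_primed := fun _ _ _ _ h1 h2 _ ⟨_, ha⟩ ⟨_, hb⟩ => by
        rw [ha]
        exact T.row_primed _ _ h1 h2 (ha.symm.trans hb) }
  have : 2 * p.1.1 ≤ T.entry p := hF.two_mul_row_le p.1.1 p.1.2 (mem_diagram p) _ ⟨p.2, rfl⟩
  rw [varIndex]
  omega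

/-- The boxes whose entry is `i` or `i'`. -/
def level (T : ShBTP lam .empty) (i : ℕ) : Finset (lam.skewDiagram .empty) :=
  Finset.univ.filter fun p => varIndex (T.entry p) = i

theorem surjOn_part (T : ShBTP lam .empty) (i : ℕ) :
    Set.SurjOn T.blocks.part (T.level i)
      (T.blocks.parts.filter fun B => ∃ p ∈ B, varIndex (T.entry p) = i) := by
  intro B hB
  obtain ⟨hB, p, hp, hi⟩ := Finset.mem_filter.mp (Finset.mem_coe.mp hB)
  exact ⟨p, Finset.mem_coe.mpr (Finset.mem_filter.mpr ⟨Finset.mem_univ p, hi⟩),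
    T.blocks.part_eq_of_mem hB hp⟩

theorem weight_le_card_level (T : ShBTP lam .empty) (i : ℕ) : T.weight i ≤ (T.level i).card :=
  Finset.card_le_card_of_surjOn _ (T.surjOn_part i)

theorem sum_card_level (T : ShBTP lam .empty) (k : ℕ) :
    ∑ i ∈ Finset.range k, (T.level i).card =
      (Finset.univ.filter fun p => varIndex (T.entry p) < k).card := by
  rw [Finset.card_eq_sum_card_fiberwise (f := fun p => varIndex (T.entry p)) (t := Finset.range k)
    (fun p hp => by simpa using (Finset.mem_filter.mp hp).2)]
  refine Finset.sum_congr rfl fun i hi => ?_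
  rw [Finset.filter_filter, level]
  congr 1
  refine Finset.filter_congr fun p _ => ?_
  have := Finset.mem_range.mp hi
  omega

theorem filter_varIndex_subset (T : ShBTP lam .empty) (k : ℕ) :
    (Finset.univ.filter fun p => varIndex (T.entry p) < k) ⊆
      Finset.univ.filter fun p : lam.skewDiagram .empty => p.1.1 < k := by
  intro p hp
  exact Finset.mem_filter.mpr ⟨Finset.mem_univ p,
    (T.row_le_varIndex p).trans_lt (Finset.mem_filter.mp hp).2⟩

theorem card_filter_row (lam : StrictPartition) (k : ℕ) :
    (Finset.univ.filter fun p : lam.skewDiagram .empty => p.1.1 < k).card = psum lam.expo k := by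
  rw [StrictPartition.psum_expo, Finset.card_filter, Finset.card_filter,
    Finset.sum_coe_sort (lam.skewDiagram .empty) fun p => if p.1 < k then 1 else 0,
    StrictPartition.skewDiagram_empty]

theorem psum_weight_le_sum (T : ShBTP lam .empty) (k : ℕ) :
    psum T.weight k ≤ ∑ i ∈ Finset.range k, (T.level i).card :=
  Finset.sum_le_sum fun i _ => T.weight_le_card_level i

theorem sum_le_psum_expo (T : ShBTP lam .empty) (k : ℕ) :
    ∑ i ∈ Finset.range k, (T.level i).card ≤ psum lam.expo k := by
  rw [sum_card_level, ← card_filter_row]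
  exact Finset.card_le_card (T.filter_varIndex_subset k)

theorem psum_weight_le (T : ShBTP lam .empty) : psum T.weight ≤ psum lam.expo := fun k =>
  (T.psum_weight_le_sum k).trans (T.sum_le_psum_expo k)

/-- The shifted bar tableau with entry `i` in all boxes of row `i` and with blocks of size one. -/
def highest (lam : StrictPartition) : ShBTP lam .empty where
  entry p := 2 * p.1.1 + 1
  row_weak p q h _ := by omega
  col_weak p q _ h := by omega
  col_unprimed p q _ h h' := by omega
  row_primed p q _ _ _ := by
    rw [IsPrimed, Nat.even_iff]
    omega
  diag_unprimed p _ := by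
    rw [IsPrimed, Nat.even_iff]
    omega
  blocks := ⊥
  block_const B hB p hp q hq := by
    obtain ⟨r, -, rfl⟩ := Finpartition.mem_bot_iff.mp hB
    rw [Finset.mem_singleton.mp hp, Finset.mem_singleton.mp hq]
  block_adjacent B hB p hp q hq := by
    obtain ⟨r, -, rfl⟩ := Finpartition.mem_bot_iff.mp hB
    rw [Finset.mem_singleton.mp hp, Finset.mem_singleton.mp hq]

theorem weight_highest (lam : StrictPartition) : (highest lam).weight = lam.expo := by
  classical
  have hv : ∀ p : lam.skewDiagram .empty, varIndex ((highest lam).entry p) = p.1.1 := by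
    intro p
    change (2 * p.1.1 + 1) / 2 = _
    omega
  ext i
  have h1 : (highest lam).weight i = ((highest lam).level i).card := by
    refine le_antisymm (weight_le_card_level _ i) ?_
    refine Finset.card_le_card_of_injOn (fun p => {p}) (fun p hp => ?_)
      fun p _ q _ h => Finset.singleton_injective h
    refine Finset.mem_coe.mpr (Finset.mem_filter.mpr ⟨?_, p, Finset.mem_singleton_self p, ?_⟩)
    · exact Finpartition.mem_bot_iff.mpr ⟨p, Finset.mem_univ p, rfl⟩
    · exact (Finset.mem_filter.mp (Finset.mem_coe.mp hp)).2
  rw [h1, level, Finset.card_filter, StrictPartition.expo_apply,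
    ← StrictPartition.card_filter_diagram_row, Finset.card_filter]
  simp only [hv]
  rw [Finset.sum_coe_sort (lam.skewDiagram .empty) fun p => if p.1 = i then 1 else 0,
    StrictPartition.skewDiagram_empty]

theorem eq_highest_of_weight_eq (T : ShBTP lam .empty) (h : T.weight = lam.expo) :
    T = highest lam := by
  have hsum : ∀ k, ∑ i ∈ Finset.range k, (T.level i).card = psum lam.expo k := fun k =>
    le_antisymm (T.sum_le_psum_expo k) (h ▸ T.psum_weight_le_sum k)
  have hindex : ∀ p, varIndex (T.entry p) = p.1.1 := by
    intro p
    refine le_antisymm ?_ (T.row_le_varIndex p)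
    have heq := Finset.eq_of_subset_of_card_le (T.filter_varIndex_subset (p.1.1 + 1))
      (by rw [card_filter_row, ← hsum, sum_card_level])
    have hp : p ∈ Finset.univ.filter fun q => varIndex (T.entry q) < p.1.1 + 1 := by
      rw [heq]
      simp
    exact Nat.lt_succ_iff.mp (Finset.mem_filter.mp hp).2
  refine ext_entry_blocks (fun p => ?_) (finpartition_eq_bot _ fun p q hpq => ?_)
  · -- The box of the diagonal in the row of `p` has an unprimed entry.
    change T.entry p = 2 * p.1.1 + 1
    have hp := (StrictPartition.mem_diagram lam p.1).mp (mem_diagram p)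
    have hd : (p.1.1, p.1.1) ∈ lam.skewDiagram .empty :=
      mem_skewDiagram ((StrictPartition.mem_diagram lam _).mpr ⟨le_rfl, by dsimp only; omega⟩)
    have h1 := hindex ⟨_, hd⟩
    have h2 := T.diag_unprimed ⟨_, hd⟩ rfl
    have h3 := hindex p
    rw [IsPrimed, Nat.even_iff] at h2
    rw [varIndex] at h1 h3
    dsimp only at h1
    rcases eq_or_lt_of_le hp.1 with he | hlt
    · have : p = ⟨_, hd⟩ := Subtype.ext (Prod.ext rfl he.symm)
      rw [← this] at h2
      omega
    · have := T.row_weak ⟨_, hd⟩ p rfl hlt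
      omega
  · have hw : ∀ i, (T.level i).card = T.weight i := by
      intro i
      have h1 := hsum i
      have h2 := hsum (i + 1)
      rw [Finset.sum_range_succ, psum_succ] at h2
      rw [h]
      omega
    have hB : ∃ r ∈ T.blocks.part p, varIndex (T.entry r) = p.1.1 :=
      ⟨p, T.blocks.mem_part (Finset.mem_univ p), hindex p⟩
    have hp : p ∈ T.level p.1.1 := Finset.mem_filter.mpr ⟨Finset.mem_univ p, hindex p⟩
    have hq : q ∈ T.level p.1.1 := by
      refine Finset.mem_filter.mpr ⟨Finset.mem_univ q, ?_⟩
      have hqp : q ∈ T.blocks.part p := hpq ▸ T.blocks.mem_part (Finset.mem_univ q)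
      rw [T.block_const _ (T.blocks.part_mem.mpr (Finset.mem_univ p)) q hqp p
        (T.blocks.mem_part (Finset.mem_univ p)), hindex p]
    refine Finset.injOn_of_surjOn_of_card_le _ (fun r hr => ?_) (T.surjOn_part p.1.1)
      (hw _).le (Finset.mem_coe.mpr hp) (Finset.mem_coe.mpr hq) hpq
    exact Finset.mem_coe.mpr (Finset.mem_filter.mpr ⟨T.blocks.part_mem.mpr (Finset.mem_univ r), r,
      T.blocks.mem_part (Finset.mem_univ r), (Finset.mem_filter.mp (Finset.mem_coe.mp hr)).2⟩)

end ShBTP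

theorem psum_le_of_coeff_barGenFun_ne_zero {lam : StrictPartition} {m : ℕ →₀ ℕ}
    (h : coeff m (barGenFun lam .empty) ≠ 0) : psum m ≤ psum lam.expo := by
  by_contra hT
  exact h (finsum_eq_zero_of_forall_eq_zero fun T =>
    MvPowerSeries.coeff_monomial_ne (fun hw => hT (by rw [hw]; exact T.psum_weight_le)) _)

theorem coeff_expo_barGenFun (lam : StrictPartition) :
    coeff lam.expo (barGenFun lam .empty) = 1 := by
  change ∑ᶠ T : ShBTP lam .empty, coeff lam.expo (monomial T.weight
      ((-beta) ^ ((lam.skewDiagram .empty).card - T.size))) = 1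
  rw [finsum_eq_single _ (ShBTP.highest lam)]
  · have hs : (ShBTP.highest lam).size = (lam.skewDiagram .empty).card := by
      change (⊥ : Finpartition (Finset.univ : Finset (lam.skewDiagram .empty))).parts.card = _
      rw [Finpartition.card_bot, Finset.card_univ, Fintype.card_coe]
    rw [ShBTP.weight_highest, MvPowerSeries.coeff_monomial_same, hs, Nat.sub_self, pow_zero]
  · intro T hT
    exact MvPowerSeries.coeff_monomial_ne
      (fun h => hT (T.eq_highest_of_weight_eq h.symm)) _

/-! ### The Cauchy kernel is multiplicative in its second set of variables -/

/-- The underlying function of `splitVars`. -/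
def splitFun (F : MvPowerSeries (ℕ ⊕ ℕ) Zbeta) : MvPowerSeries ℕ PS :=
  fun a => (fun m => coeff (Finsupp.sumElim m a) F : PS)

theorem coeff_coeff_splitFun (F : MvPowerSeries (ℕ ⊕ ℕ) Zbeta) (m a : ℕ →₀ ℕ) :
    coeff m (coeff a (splitFun F)) = coeff (Finsupp.sumElim m a) F := rfl

/-- A power series in two sets of variables, viewed as a power series in the second set whose
coefficients are power series in the first set. -/
def splitVars : MvPowerSeries (ℕ ⊕ ℕ) Zbeta →+* MvPowerSeries ℕ PS where
  toFun := splitFun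
  map_one' := by
    classical
    refine MvPowerSeries.ext fun a => MvPowerSeries.ext fun m => ?_
    rw [coeff_coeff_splitFun, MvPowerSeries.coeff_one, MvPowerSeries.coeff_one]
    by_cases ha : a = 0
    · by_cases hm : m = 0
      · subst ha hm
        rw [if_pos, if_pos rfl, MvPowerSeries.coeff_one, if_pos rfl]
        ext (i | i) <;> simp
      · rw [if_neg, if_pos ha, MvPowerSeries.coeff_one, if_neg hm]
        intro h
        refine hm (Finsupp.ext fun i => ?_)
        simpa using DFunLike.congr_fun h (Sum.inl i)
    · rw [if_neg, if_neg ha, map_zero]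
      intro h
      refine ha (Finsupp.ext fun i => ?_)
      simpa using DFunLike.congr_fun h (Sum.inr i)
  map_mul' F G := by
    classical
    refine MvPowerSeries.ext fun a => MvPowerSeries.ext fun m => ?_
    rw [coeff_coeff_splitFun, MvPowerSeries.coeff_mul, MvPowerSeries.coeff_mul, map_sum]
    simp only [MvPowerSeries.coeff_mul]
    rw [← Finset.sum_product']
    have key : ∀ n : ℕ ⊕ ℕ →₀ ℕ, Finsupp.sumElim (n.comapDomain Sum.inl Sum.inl_injective.injOn)
        (n.comapDomain Sum.inr Sum.inr_injective.injOn) = n := fun n => by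
      ext (i | i) <;> simp
    refine Finset.sum_bij'
      (fun p _ => ((p.1.comapDomain Sum.inr Sum.inr_injective.injOn,
          p.2.comapDomain Sum.inr Sum.inr_injective.injOn),
        (p.1.comapDomain Sum.inl Sum.inl_injective.injOn,
          p.2.comapDomain Sum.inl Sum.inl_injective.injOn)))
      (fun p _ => (Finsupp.sumElim p.2.1 p.1.1, Finsupp.sumElim p.2.2 p.1.2)) ?_ ?_ ?_ ?_ ?_
    · rintro ⟨p, q⟩ h
      have h' := Finset.HasAntidiagonal.mem_antidiagonal.mp h
      refine Finset.mem_product.mpr ⟨Finset.HasAntidiagonal.mem_antidiagonal.mpr ?_,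
        Finset.HasAntidiagonal.mem_antidiagonal.mpr ?_⟩
      · ext i
        simpa using DFunLike.congr_fun h' (Sum.inr i)
      · ext i
        simpa using DFunLike.congr_fun h' (Sum.inl i)
    · rintro ⟨⟨p, q⟩, r, s⟩ h
      obtain ⟨h1, h2⟩ := Finset.mem_product.mp h
      have h1' := Finset.HasAntidiagonal.mem_antidiagonal.mp h1
      have h2' := Finset.HasAntidiagonal.mem_antidiagonal.mp h2
      refine Finset.HasAntidiagonal.mem_antidiagonal.mpr ?_
      ext (i | i)
      · simpa using DFunLike.congr_fun h2' i
      · simpa using DFunLike.congr_fun h1' i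
    · rintro ⟨p, q⟩ -
      simp only [key]
    · rintro ⟨⟨p, q⟩, r, s⟩ -
      ext i <;> simp
    · rintro ⟨p, q⟩ -
      simp only [coeff_coeff_splitFun, key]
  map_zero' := rfl
  map_add' _ _ := rfl

theorem coeff_coeff_splitVars (F : MvPowerSeries (ℕ ⊕ ℕ) Zbeta) (m a : ℕ →₀ ℕ) :
    coeff m (coeff a (splitVars F)) = coeff (Finsupp.sumElim m a) F := rfl

theorem splitVars_monomial (m a : ℕ →₀ ℕ) (r : Zbeta) :
    splitVars (monomial (Finsupp.sumElim m a) r) = monomial a (monomial m r) := by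
  classical
  refine MvPowerSeries.ext fun b => MvPowerSeries.ext fun n => ?_
  rw [coeff_coeff_splitVars, MvPowerSeries.coeff_monomial, MvPowerSeries.coeff_monomial]
  by_cases hb : b = a
  · subst hb
    rw [if_pos rfl, MvPowerSeries.coeff_monomial]
    congr 1
    refine propext ⟨fun h => Finsupp.ext fun i => ?_, fun h => by rw [h]⟩
    simpa using DFunLike.congr_fun h (Sum.inl i)
  · rw [if_neg hb, map_zero, if_neg]
    intro h
    refine hb (Finsupp.ext fun i => ?_)
    simpa using DFunLike.congr_fun h (Sum.inr i)

theorem splitVars_X_inl (i : ℕ) :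
    splitVars (MvPowerSeries.X (Sum.inl i)) = MvPowerSeries.C (MvPowerSeries.X i) := by
  have h : (Finsupp.single (Sum.inl i) 1 : ℕ ⊕ ℕ →₀ ℕ) =
      Finsupp.sumElim (Finsupp.single i 1) 0 := by
    ext (k | k) <;> simp [Finsupp.single_apply]
  rw [MvPowerSeries.X_def, h, splitVars_monomial, ← MvPowerSeries.monomial_zero_eq_C_apply,
    MvPowerSeries.X_def]

theorem splitVars_X_inr (j : ℕ) :
    splitVars (MvPowerSeries.X (Sum.inr j)) = MvPowerSeries.X j := by
  have h : (Finsupp.single (Sum.inr j) 1 : ℕ ⊕ ℕ →₀ ℕ) =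
      Finsupp.sumElim 0 (Finsupp.single j 1) := by
    ext (k | k) <;> simp [Finsupp.single_apply]
  rw [MvPowerSeries.X_def, h, splitVars_monomial, MvPowerSeries.X_def,
    MvPowerSeries.monomial_zero_one]

theorem splitVars_C (r : Zbeta) :
    splitVars (MvPowerSeries.C r) = MvPowerSeries.C (MvPowerSeries.C r) := by
  have h : (0 : ℕ ⊕ ℕ →₀ ℕ) = Finsupp.sumElim 0 0 := by
    ext (k | k) <;> simp
  rw [← MvPowerSeries.monomial_zero_eq_C_apply, h, splitVars_monomial,
    MvPowerSeries.monomial_zero_eq_C_apply, MvPowerSeries.monomial_zero_eq_C_apply]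

/-- The power series `x̄ᵢ`. -/
def xbar (i : ℕ) : PS :=
  -MvPowerSeries.X i *
    MvPowerSeries.invOfUnit (1 + MvPowerSeries.C beta * MvPowerSeries.X i) 1

/-- The factor `(1 - x̄ᵢ y) / (1 - xᵢ y)`, as a power series in a single variable `y`. -/
def kernelFactor (i : ℕ) : PowerSeries PS :=
  (1 - PowerSeries.C (xbar i) * PowerSeries.X) *
    PowerSeries.invOfUnit (1 - PowerSeries.C (MvPowerSeries.X i) * PowerSeries.X) 1

theorem map_eq_of_mul_eq_one {R S : Type*} [CommRing R] [CommRing S] (φ : R →+* S) {a a' : R}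
    {b b' : S} (h : a * a' = 1) (h' : b * b' = 1) (hab : φ a = b) : φ a' = b' :=
  left_inv_eq_right_inv (a := b) (by rw [← hab, ← map_mul, mul_comm, h, map_one]) h'

theorem splitVars_cauchyFactor (i j : ℕ) :
    splitVars (cauchyFactor (i, j)) = PowerSeries.toMvPowerSeries j (kernelFactor i) := by
  have h1 : splitVars (MvPowerSeries.invOfUnit
      (1 + MvPowerSeries.C beta * MvPowerSeries.X (Sum.inl i)) 1) =
      MvPowerSeries.C (MvPowerSeries.invOfUnit
        (1 + MvPowerSeries.C beta * MvPowerSeries.X i) 1) := by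
    refine map_eq_of_mul_eq_one splitVars (MvPowerSeries.mul_invOfUnit _ 1 (by simp))
      (b := MvPowerSeries.C (1 + MvPowerSeries.C beta * MvPowerSeries.X i)) ?_ ?_
    · rw [← map_mul, MvPowerSeries.mul_invOfUnit _ 1 (by simp), map_one]
    · rw [map_add, map_mul, splitVars_C, splitVars_X_inl, map_one, map_add, map_mul, map_one]
  have h2 : splitVars (MvPowerSeries.invOfUnit
      (1 - MvPowerSeries.X (Sum.inl i) * MvPowerSeries.X (Sum.inr j)) 1) =
      PowerSeries.toMvPowerSeries j (PowerSeries.invOfUnit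
        (1 - PowerSeries.C (MvPowerSeries.X i) * PowerSeries.X) 1) := by
    refine map_eq_of_mul_eq_one splitVars (MvPowerSeries.mul_invOfUnit _ 1 (by simp))
      (b := PowerSeries.toMvPowerSeries j
        (1 - PowerSeries.C (MvPowerSeries.X i) * PowerSeries.X)) ?_ ?_
    · rw [← map_mul, PowerSeries.mul_invOfUnit _ 1 (by simp), map_one]
    · rw [map_sub, map_mul, splitVars_X_inl, splitVars_X_inr, map_one, map_sub, map_mul, map_one,
        PowerSeries.toMvPowerSeries_C, PowerSeries.toMvPowerSeries_X]
  simp only [cauchyFactor, kernelFactor, xbar, map_mul, map_sub, map_neg, map_one, h1, h2,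
    splitVars_X_inl, splitVars_X_inr, PowerSeries.toMvPowerSeries_C,
    PowerSeries.toMvPowerSeries_X]

theorem coeff_toMvPowerSeries {R : Type*} [CommRing R] (j : ℕ) (U : PowerSeries R) (a : ℕ →₀ ℕ) :
    coeff a (PowerSeries.toMvPowerSeries j U) =
      if a = Finsupp.single j (a j) then PowerSeries.coeff (a j) U else 0 := by
  split_ifs with h
  · have h1 := MvPowerSeries.coeff_embDomain_rename (R := R)
      (⟨fun _ => j, fun _ _ _ => rfl⟩ : Unit ↪ ℕ) U (Finsupp.single () (a j))
    rw [Finsupp.embDomain_single] at h1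
    rw [h, PowerSeries.toMvPowerSeries_apply, Finsupp.single_eq_same]
    exact h1
  · rw [PowerSeries.toMvPowerSeries_apply]
    refine MvPowerSeries.coeff_rename_eq_zero _ _ ?_
    rintro ⟨b, rfl⟩
    refine h ?_
    have hb : b = Finsupp.single () (b ()) := by
      ext
      simp
    rw [hb, Finsupp.mapDomain_single]
    simp

/-- The coefficients of a product of univariate power series in distinct variables. -/
theorem coeff_prod_toMvPowerSeries {R : Type*} [CommRing R] (U : PowerSeries R) (s : Finset ℕ)
    (a : ℕ →₀ ℕ) : coeff a (∏ j ∈ s, PowerSeries.toMvPowerSeries j U) =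
      if a.support ⊆ s then ∏ j ∈ s, PowerSeries.coeff (a j) U else 0 := by
  classical
  induction s using Finset.induction_on generalizing a with
  | empty =>
    rw [Finset.prod_empty, Finset.prod_empty, MvPowerSeries.coeff_one]
    simp
  | insert j s hj ih =>
    rw [Finset.prod_insert hj, Finset.prod_insert hj, MvPowerSeries.coeff_mul,
      Finset.sum_eq_single (Finsupp.single j (a j), a.erase j)]
    · rw [coeff_toMvPowerSeries, if_pos (by simp), ih, Finsupp.single_eq_same]
      have h1 : (a.erase j).support ⊆ s ↔ a.support ⊆ insert j s := by
        rw [Finsupp.support_erase, Finset.subset_insert_iff]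
      simp only [h1]
      split_ifs
      · congr 1
        refine Finset.prod_congr rfl fun k hk => ?_
        rw [Finsupp.erase_ne]
        rintro rfl
        exact hj hk
      · rw [mul_zero]
    · rintro ⟨p, q⟩ hpq hne
      have hpq' := Finset.HasAntidiagonal.mem_antidiagonal.mp hpq
      dsimp only at hpq' ⊢
      rw [coeff_toMvPowerSeries, ih]
      split_ifs with hp hq
      · refine absurd ?_ hne
        have hqj : q j = 0 := by
          by_contra h
          exact hj (hq (Finsupp.mem_support_iff.mpr h))
        have hpj : p j = a j := by
          rw [← hpq', Finsupp.add_apply, hqj, add_zero]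
        have h1 : p = Finsupp.single j (a j) := by rw [← hpj]; exact hp
        refine Prod.ext h1 ?_
        ext k
        dsimp only
        by_cases hk : k = j
        · subst hk
          simp [hqj]
        · rw [Finsupp.erase_ne hk, ← hpq', Finsupp.add_apply, h1,
            Finsupp.single_eq_of_ne hk, zero_add]
      · rw [mul_zero]
      · rw [zero_mul]
      · rw [zero_mul]
    · intro h
      exact absurd (Finset.HasAntidiagonal.mem_antidiagonal.mpr
        (Finsupp.single_add_erase j a)) h

/-- The partial products of the factors of the Cauchy kernel for a single variable `y`. -/
def kernelProd (n : ℕ) : PowerSeries PS := ∏ i ∈ Finset.range n, kernelFactor i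

theorem coeff_zero_kernelProd (n : ℕ) : PowerSeries.coeff 0 (kernelProd n) = 1 := by
  rw [PowerSeries.coeff_zero_eq_constantCoeff_apply, kernelProd, map_prod]
  refine Finset.prod_eq_one fun i _ => ?_
  simp [kernelFactor]

theorem eventually_coeff_kernel {D : MvPowerSeries (ℕ ⊕ ℕ) Zbeta}
    (hD : IsFormalProd cauchyFactor D) (a m : ℕ →₀ ℕ) :
    ∀ᶠ n in Filter.atTop, coeff m (a.prod fun _ k => PowerSeries.coeff k (kernelProd n)) =
      coeff m (coeff a (splitVars D)) := by
  classical
  have ht : Filter.Tendsto (fun n => Finset.range n ×ˢ Finset.range n) Filter.atTop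
      Filter.atTop := by
    refine Filter.tendsto_atTop_finset_of_monotone (fun n k h => ?_) fun p => ?_
    · exact Finset.product_subset_product (Finset.range_mono h) (Finset.range_mono h)
    · refine ⟨p.1 + p.2 + 1, Finset.mem_product.mpr ⟨?_, ?_⟩⟩ <;> rw [Finset.mem_range] <;> omega
  obtain ⟨N, hN⟩ := a.support.exists_nat_subset_range
  filter_upwards [ht.eventually (hD (Finsupp.sumElim m a)), Filter.eventually_ge_atTop N]
    with n hn hNn
  have hsub : a.support ⊆ Finset.range n := hN.trans (Finset.range_mono hNn)
  rw [coeff_coeff_splitVars, ← hn, ← coeff_coeff_splitVars, map_prod, Finset.prod_product_right]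
  simp only [splitVars_cauchyFactor]
  simp only [← map_prod]
  rw [← kernelProd, coeff_prod_toMvPowerSeries, if_pos hsub, Finsupp.prod_of_support_subset _ hsub]
  intro _ _
  exact coeff_zero_kernelProd n

/-- The coefficients of the Cauchy kernel with respect to the second set of variables are closed
under multiplication: a product of two coefficients is the coefficient of the product of the first
monomial with a shifted copy of the second. -/
theorem exists_coeff_kernel_mul {D : MvPowerSeries (ℕ ⊕ ℕ) Zbeta}
    (hD : IsFormalProd cauchyFactor D) (a b : ℕ →₀ ℕ) :
    ∃ c, coeff a (splitVars D) * coeff b (splitVars D) = coeff c (splitVars D) := by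
  classical
  obtain ⟨N, hN⟩ := a.support.exists_nat_subset_range
  have hinj : Function.Injective fun k : ℕ => k + N := add_left_injective N
  refine ⟨a + b.mapDomain fun k => k + N, MvPowerSeries.ext fun m => ?_⟩
  have hprod : ∀ n, ((a + b.mapDomain fun k => k + N).prod fun _ k =>
      PowerSeries.coeff k (kernelProd n)) =
      (a.prod fun _ k => PowerSeries.coeff k (kernelProd n)) *
        b.prod fun _ k => PowerSeries.coeff k (kernelProd n) := by
    intro n
    rw [Finsupp.prod_add_index_of_disjoint, Finsupp.prod_mapDomain_index_inj hinj]
    rw [Finsupp.mapDomain_support_of_injective hinj, Finset.disjoint_left]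
    intro k hk hk'
    obtain ⟨i, -, hi⟩ := Finset.mem_image.mp hk'
    have := Finset.mem_range.mp (hN hk)
    omega
  have hall : ∀ᶠ n in Filter.atTop, ∀ p ∈ Finset.HasAntidiagonal.antidiagonal m,
      coeff p.1 (a.prod fun _ k => PowerSeries.coeff k (kernelProd n)) =
        coeff p.1 (coeff a (splitVars D)) ∧
      coeff p.2 (b.prod fun _ k => PowerSeries.coeff k (kernelProd n)) =
        coeff p.2 (coeff b (splitVars D)) :=
    (Filter.eventually_all_finset _).mpr fun p _ =>
      (eventually_coeff_kernel hD a p.1).and (eventually_coeff_kernel hD b p.2)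
  obtain ⟨n, h1, h2⟩ := (hall.and (eventually_coeff_kernel hD
    (a + b.mapDomain fun k => k + N) m)).exists
  rw [← h2, hprod, MvPowerSeries.coeff_mul, MvPowerSeries.coeff_mul]
  refine Finset.sum_congr rfl fun p hp => ?_
  rw [(h1 p hp).1, (h1 p hp).2]

/-! ### The dual functions `gp` -/

/-- The coefficient of `GQ_λ` in the expansion of `GQ_μ GQ_ν`, including the power of `β`. -/
def prodCoeff (mu nu : StrictPartition) (b : StrictPartition → ℤ) (lam : StrictPartition) :
    Zbeta :=
  (b lam : Zbeta) * beta ^ (lam.size - mu.size - nu.size)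

theorem isProductExpansion_iff {mu nu : StrictPartition} {b : StrictPartition → ℤ} :
    IsProductExpansion mu nu b ↔ (∀ lam, lam.size < mu.size + nu.size → b lam = 0) ∧
      GQ mu * GQ nu = gqSum (prodCoeff mu nu b) :=
  and_congr_right fun _ => ⟨fun h => h.2, fun h => h ▸ isFormalSum_gqSum _⟩

theorem beta_ne_zero : beta ≠ 0 := Polynomial.X_ne_zero

theorem IsProductExpansion.unique {mu nu : StrictPartition} {b e : StrictPartition → ℤ}
    (hb : IsProductExpansion mu nu b) (he : IsProductExpansion mu nu e) : b = e := by
  funext lam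
  have h := congrFun (gqSum_injective ((isProductExpansion_iff.mp hb).2.symm.trans
    (isProductExpansion_iff.mp he).2)) lam
  exact_mod_cast mul_right_cancel₀ (pow_ne_zero _ beta_ne_zero) h

theorem isProductExpansion_bCoeff {mu nu : StrictPartition}
    (h : ∃ b, IsProductExpansion mu nu b) : IsProductExpansion mu nu (bCoeff mu nu) := by
  rw [bCoeff, dif_pos h]
  exact h.choose_spec

open Classical in
theorem bCoeff_empty (nu : StrictPartition) : bCoeff .empty nu = Pi.single nu 1 := by
  have h : IsProductExpansion .empty nu (Pi.single nu 1) := by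
    refine isProductExpansion_iff.mpr ⟨fun lam h => Pi.single_eq_of_ne ?_ _, ?_⟩
    · rintro rfl
      rw [StrictPartition.size_empty] at h
      omega
    · rw [GQ_empty, one_mul, ← gqSum_single nu]
      congr 1
      funext lam
      by_cases hl : lam = nu
      · subst hl
        simp [prodCoeff, StrictPartition.size_empty]
      · simp [prodCoeff, hl]
  exact (isProductExpansion_bCoeff ⟨_, h⟩).unique h

theorem gpSkew_empty (lam : StrictPartition) : gpSkew lam .empty = gp lam := by
  classical
  rw [gpSkew, finsum_eq_single _ lam]
  · simp [bCoeff_empty, StrictPartition.size_empty]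
  · intro nu hnu
    rw [bCoeff_empty, Pi.single_eq_of_ne hnu.symm]
    simp

theorem omega_gp (hjp : JpFormula) (lam : StrictPartition) :
    omega (gp lam) = barGenFun lam .empty := by
  rw [← hjp lam .empty lam.empty_contained, jpSkew, gpSkew_empty]

theorem barGenFun_ne_zero (lam : StrictPartition) : barGenFun lam .empty ≠ 0 := fun h => by
  have := coeff_expo_barGenFun lam
  rw [h, map_zero] at this
  exact zero_ne_one this

/-- The formula for `jp` contains the statement that `gp_λ` has a Schur expansion: by convention, `ω`
vanishes on a power series without one. -/
theorem exists_isSchurExpansion_gp (hjp : JpFormula) (lam : StrictPartition) :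
    ∃ c, IsSchurExpansion (gp lam) c := by
  by_contra h
  refine barGenFun_ne_zero lam ?_
  rw [← omega_gp hjp, omega, dif_neg h]

/-- The formula for `jp` contains the statement that the Cauchy identity has a solution: by
convention, `gp` vanishes without one, and then so does `ω(gp_∅)`. -/
theorem cauchyIdentity_gp (hjp : JpFormula) : CauchyIdentity gp := by
  by_cases h : ∃ g, CauchyIdentity g
  · rw [gp, dif_pos h]
    exact h.choose_spec
  · refine absurd ?_ (barGenFun_ne_zero .empty)
    rw [← omega_gp hjp, gp, dif_neg h, Pi.zero_apply, omega_zero]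

/-- The functions `gp_λ` are separated by finite linear combinations of coefficients. -/
theorem exists_dual_functional (hjp : JpFormula) (kap : StrictPartition) :
    ∃ φ ∈ coeffSpan, φ (gp kap) = 1 ∧
      ∀ lam, lam.size ≤ kap.size → lam ≠ kap → φ (gp lam) = 0 := by
  classical
  choose θ hθ hθ' using exists_omega_functional
  have hcoeff : ∀ m lam, θ m (gp lam) = coeff m (barGenFun lam .empty) := fun m lam => by
    rw [← omega_gp hjp, hθ' m _ (exists_isSchurExpansion_gp hjp lam)]
  obtain ⟨l, hl⟩ := exists_left_inverse_of_dominance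
    (ι := {lam // lam ∈ (sizeLE kap.size).filter fun lam => lam.size = kap.size})
    (fun lam => lam.1.expo) (fun a b h => Subtype.ext (StrictPartition.expo_injective h))
    (fun a b => coeff a.1.expo (barGenFun b.1 .empty)) (fun a => coeff_expo_barGenFun a.1)
    (fun a b h => psum_le_of_coeff_barGenFun_ne_zero h) ⟨kap, by simp⟩
  have heval : ∀ lam, (∑ a, l a • θ a.1.expo) (gp lam) =
      ∑ a, l a * coeff a.1.expo (barGenFun lam .empty) := fun lam => by
    simp only [LinearMap.sum_apply, LinearMap.smul_apply, smul_eq_mul, hcoeff]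
  refine ⟨∑ a, l a • θ a.1.expo, Submodule.sum_mem _ fun a _ => Submodule.smul_mem _ _ (hθ _),
    ?_, fun lam hlam hne => ?_⟩
  · rw [heval]
    exact (hl ⟨kap, by simp⟩).trans (if_pos rfl)
  · rw [heval]
    rcases hlam.lt_or_eq with hlt | heq
    · refine Finset.sum_eq_zero fun a _ => ?_
      have h0 : coeff a.1.expo (barGenFun lam .empty) = 0 := by
        by_contra h
        have h1 := degree_le_of_psum_le (psum_le_of_coeff_barGenFun_ne_zero h)
        rw [StrictPartition.degree_expo, StrictPartition.degree_expo] at h1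
        have h2 := (Finset.mem_filter.mp a.2).2
        omega
      rw [h0, mul_zero]
    · refine (hl ⟨lam, by simp [heq]⟩).trans (if_neg fun h => hne ?_)
      exact (Subtype.ext_iff.mp h).symm

/-! ### Existence of the product expansions -/

theorem splitVars_inX (f : PS) : splitVars (inX f) = MvPowerSeries.C f := by
  classical
  refine MvPowerSeries.ext fun a => MvPowerSeries.ext fun m => ?_
  rw [coeff_coeff_splitVars, MvPowerSeries.coeff_C, inX]
  split_ifs with ha
  · subst ha
    have h : Finsupp.sumElim m (0 : ℕ →₀ ℕ) = m.embDomain Function.Embedding.inl := by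
      ext (i | i)
      · exact (Finsupp.embDomain_apply_self Function.Embedding.inl m i).symm
      · rw [Finsupp.embDomain_of_notMem_range]
        · simp
        · simp
    rw [h]
    exact MvPowerSeries.coeff_embDomain_rename Function.Embedding.inl f m
  · rw [map_zero]
    refine MvPowerSeries.coeff_rename_eq_zero _ _ ?_
    rintro ⟨b, hb⟩
    refine ha (Finsupp.ext fun i => ?_)
    have := DFunLike.congr_fun hb (Sum.inr i)
    rw [Finsupp.mapDomain_of_notMem_range _ _ (by simp)] at this
    simpa using this.symm

theorem splitVars_inY (f : PS) :
    splitVars (inY f) = MvPowerSeries.map (MvPowerSeries.C (σ := ℕ)) f := by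
  classical
  refine MvPowerSeries.ext fun a => MvPowerSeries.ext fun m => ?_
  rw [coeff_coeff_splitVars, MvPowerSeries.coeff_map, MvPowerSeries.coeff_C, inY]
  split_ifs with hm
  · subst hm
    have h : Finsupp.sumElim (0 : ℕ →₀ ℕ) a = a.embDomain Function.Embedding.inr := by
      ext (i | i)
      · rw [Finsupp.embDomain_of_notMem_range]
        · simp
        · simp
      · exact (Finsupp.embDomain_apply_self Function.Embedding.inr a i).symm
    rw [h]
    exact MvPowerSeries.coeff_embDomain_rename Function.Embedding.inr f a
  · refine MvPowerSeries.coeff_rename_eq_zero _ _ ?_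
    rintro ⟨b, hb⟩
    refine hm (Finsupp.ext fun i => ?_)
    have := DFunLike.congr_fun hb (Sum.inl i)
    rw [Finsupp.mapDomain_of_notMem_range _ _ (by simp)] at this
    simpa using this.symm

/-- The coefficients of the Cauchy kernel with respect to `y` are expansions into functions `GQ`. -/
theorem coeff_kernel_eq_gqSum {g : StrictPartition → PS} {D : MvPowerSeries (ℕ ⊕ ℕ) Zbeta}
    (hD : IsFormalSum (fun lam => inX (GQ lam) * inY (g lam)) D) (a : ℕ →₀ ℕ) :
    coeff a (splitVars D) = gqSum fun lam => coeff a (g lam) := by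
  refine MvPowerSeries.ext fun m => ?_
  rw [coeff_coeff_splitVars, hD.2]
  change ∑ᶠ lam, coeff (Finsupp.sumElim m a) (inX (GQ lam) * inY (g lam)) =
    ∑ᶠ lam, coeff m (coeff a (g lam) • GQ lam)
  refine finsum_congr fun lam => ?_
  rw [← coeff_coeff_splitVars, map_mul, splitVars_inX, splitVars_inY, MvPowerSeries.coeff_C_mul,
    MvPowerSeries.coeff_map, MvPowerSeries.coeff_mul_C, MvPowerSeries.coeff_smul, mul_comm]

/-- The span of the coefficients of the Cauchy kernel with respect to the variables `y`. -/
def kernelSpan (D : MvPowerSeries (ℕ ⊕ ℕ) Zbeta) : Submodule Zbeta PS :=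
  Submodule.span Zbeta (Set.range fun a : ℕ →₀ ℕ => coeff a (splitVars D))

theorem mul_mem_kernelSpan {D : MvPowerSeries (ℕ ⊕ ℕ) Zbeta} (hD : IsFormalProd cauchyFactor D)
    {f g : PS} (hf : f ∈ kernelSpan D) (hg : g ∈ kernelSpan D) : f * g ∈ kernelSpan D := by
  have h : kernelSpan D * kernelSpan D ≤ kernelSpan D := by
    rw [kernelSpan, Submodule.span_mul_span, Submodule.span_le]
    rintro _ ⟨_, ⟨a, rfl⟩, _, ⟨b, rfl⟩, rfl⟩
    obtain ⟨c, hc⟩ := exists_coeff_kernel_mul hD a b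
    exact Submodule.subset_span ⟨c, hc.symm⟩
  exact h (Submodule.mul_mem_mul hf hg)

theorem exists_gqSum_of_mem_kernelSpan {g : StrictPartition → PS}
    {D : MvPowerSeries (ℕ ⊕ ℕ) Zbeta}
    (hD : IsFormalSum (fun lam => inX (GQ lam) * inY (g lam)) D) {f : PS}
    (hf : f ∈ kernelSpan D) : ∃ c, f = gqSum c := by
  induction hf using Submodule.span_induction with
  | mem x hx =>
    obtain ⟨a, rfl⟩ := hx
    exact ⟨_, coeff_kernel_eq_gqSum hD a⟩
  | zero => exact ⟨0, gqSum_zero.symm⟩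
  | add x y _ _ hx hy =>
    obtain ⟨c, rfl⟩ := hx
    obtain ⟨e, rfl⟩ := hy
    exact ⟨c + e, (gqSum_add c e).symm⟩
  | smul r x _ hx =>
    obtain ⟨c, rfl⟩ := hx
    exact ⟨r • c, (gqSum_smul r c).symm⟩

theorem gqSum_mem_kernelSpan {g : StrictPartition → PS} {D : MvPowerSeries (ℕ ⊕ ℕ) Zbeta}
    (hD : IsFormalSum (fun lam => inX (GQ lam) * inY (g lam)) D) {φ : PS →ₗ[Zbeta] Zbeta}
    (hφ : φ ∈ coeffSpan) : gqSum (fun lam => φ (g lam)) ∈ kernelSpan D := by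
  induction hφ using Submodule.span_induction with
  | mem x hx =>
    obtain ⟨a, rfl⟩ := hx
    rw [← coeff_kernel_eq_gqSum hD a]
    exact Submodule.subset_span ⟨a, rfl⟩
  | zero =>
    convert Submodule.zero_mem (kernelSpan D)
    exact gqSum_zero
  | add x y _ _ hx hy =>
    convert Submodule.add_mem _ hx hy using 1
    exact gqSum_add _ _
  | smul r x _ hx =>
    convert Submodule.smul_mem _ r hx using 1
    exact gqSum_smul _ _

/-- Each `GQ_κ` agrees up to any given degree with a finite linear combination of the coefficients
of the Cauchy kernel. -/
theorem exists_approx_GQ (hjp : JpFormula) {D : MvPowerSeries (ℕ ⊕ ℕ) Zbeta}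
    (hD : IsFormalSum (fun lam => inX (GQ lam) * inY (gp lam)) D) (d n : ℕ)
    (kap : StrictPartition) (hn : d < kap.size + n) :
    ∃ q ∈ kernelSpan D, ∀ m : ℕ →₀ ℕ, m.degree ≤ d → coeff m q = coeff m (GQ kap) := by
  classical
  induction n generalizing kap with
  | zero =>
    refine ⟨0, Submodule.zero_mem _, fun m hm => ?_⟩
    rw [map_zero]
    by_contra h
    have := size_le_of_coeff_GQ_ne_zero (Ne.symm h)
    omega
  | succ n ih =>
    obtain ⟨φ, hφ, hφ1, hφ0⟩ := exists_dual_functional hjp kap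
    choose! q hq hq' using ih
    let s := (sizeLE (d ⊔ kap.size)).filter fun lam => ¬ lam.size ≤ kap.size
    have hs : ∀ lam ∈ s, d < lam.size + n := fun lam hlam => by
      have := (Finset.mem_filter.mp hlam).2
      omega
    refine ⟨gqSum (fun lam => φ (gp lam)) - ∑ lam ∈ s, φ (gp lam) • q lam,
      Submodule.sub_mem _ (gqSum_mem_kernelSpan hD hφ) (Submodule.sum_mem _ fun lam hlam =>
        Submodule.smul_mem _ _ (hq lam (hs lam hlam))), fun m hm => ?_⟩
    rw [map_sub, map_sum, coeff_gqSum_of_le _ (d := d ⊔ kap.size) (hm.trans le_sup_left),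
      ← Finset.sum_filter_add_sum_filter_not (sizeLE (d ⊔ kap.size))
        fun lam : StrictPartition => lam.size ≤ kap.size]
    have h1 : ∑ lam ∈ s, coeff m (φ (gp lam) • q lam) =
        ∑ lam ∈ s, φ (gp lam) * coeff m (GQ lam) :=
      Finset.sum_congr rfl fun lam hlam => by
        rw [MvPowerSeries.coeff_smul, hq' lam (hs lam hlam) m hm]
    rw [h1, add_sub_cancel_right, Finset.sum_eq_single kap]
    · rw [hφ1, one_mul]
    · intro lam hlam hne
      rw [hφ0 lam (Finset.mem_filter.mp hlam).2 hne, zero_mul]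
    · intro h
      exact absurd (by simp) h

/-- A power series that agrees up to any given degree with an infinite linear combination of the
functions `GQ` is such a combination. -/
theorem exists_eq_gqSum {f : PS}
    (h : ∀ d, ∃ c, ∀ m : ℕ →₀ ℕ, m.degree ≤ d → coeff m f = coeff m (gqSum c)) :
    ∃ c, f = gqSum c := by
  choose c hc using h
  refine ⟨fun lam => c lam.size lam, MvPowerSeries.ext fun m => ?_⟩
  rw [hc m.degree m le_rfl, coeff_gqSum, coeff_gqSum]
  refine Finset.sum_congr rfl fun lam hlam => ?_
  congr 1
  refine eq_of_coeff_gqSum_eq (d := lam.size) (fun k hk => ?_) le_rfl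
  rw [← hc _ k hk, ← hc _ k (hk.trans (mem_sizeLE.mp hlam))]

theorem exists_mul_eq_gqSum (hjp : JpFormula) (mu nu : StrictPartition) :
    ∃ c, GQ mu * GQ nu = gqSum c := by
  classical
  obtain ⟨D, hprod, hsum⟩ := cauchyIdentity_gp hjp
  refine exists_eq_gqSum fun d => ?_
  obtain ⟨p, hp, hp'⟩ := exists_approx_GQ hjp hsum d (d + 1) mu (by omega)
  obtain ⟨q, hq, hq'⟩ := exists_approx_GQ hjp hsum d (d + 1) nu (by omega)
  obtain ⟨c, hc⟩ := exists_gqSum_of_mem_kernelSpan hsum (mul_mem_kernelSpan hprod hp hq)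
  refine ⟨c, fun m hm => ?_⟩
  rw [← hc, MvPowerSeries.coeff_mul, MvPowerSeries.coeff_mul]
  refine Finset.sum_congr rfl fun k hk => ?_
  have hk' := congrArg Finsupp.degree (Finset.HasAntidiagonal.mem_antidiagonal.mp hk)
  rw [map_add] at hk'
  rw [hp' _ (by omega), hq' _ (by omega)]

/-- Homogeneity of degree `e` for the grading in which the variables have degree `1` and `β` has
degree `-1`. -/
def IsHomogeneous (e : ℕ) (f : PS) : Prop :=
  ∀ (m : ℕ →₀ ℕ) (k : ℕ), (coeff m f).coeff k ≠ 0 → m.degree = k + e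

theorem isHomogeneous_GQ (lam : StrictPartition) : IsHomogeneous lam.size (GQ lam) := by
  intro m k h
  have h0 : coeff m (GQ lam) ≠ 0 := fun h0 => h (by rw [h0, Polynomial.coeff_zero])
  have h1 := size_le_of_coeff_GQ_ne_zero h0
  rw [coeff_GQ, beta, ← Polynomial.C_eq_natCast, Polynomial.coeff_C_mul,
    Polynomial.coeff_X_pow] at h
  have h2 : k = m.degree - lam.size := by
    by_contra hne
    exact h (by rw [if_neg hne, mul_zero])
  omega

theorem IsHomogeneous.mul {d e : ℕ} {f g : PS} (hf : IsHomogeneous d f) (hg : IsHomogeneous e g) :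
    IsHomogeneous (d + e) (f * g) := by
  classical
  intro m k h
  rw [MvPowerSeries.coeff_mul, Polynomial.finsetSum_coeff] at h
  obtain ⟨p, hp, hp'⟩ := Finset.exists_ne_zero_of_sum_ne_zero h
  rw [Polynomial.coeff_mul] at hp'
  obtain ⟨q, hq, hq'⟩ := Finset.exists_ne_zero_of_sum_ne_zero hp'
  have h1 := hf _ _ (left_ne_zero_of_mul hq')
  have h2 := hg _ _ (right_ne_zero_of_mul hq')
  have h3 := congrArg Finsupp.degree (Finset.HasAntidiagonal.mem_antidiagonal.mp hp)
  have h4 := Finset.HasAntidiagonal.mem_antidiagonal.mp hq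
  rw [map_add] at h3
  omega

/-- The expansion of a homogeneous power series has homogeneous coefficients. -/
theorem IsHomogeneous.exists_int {e : ℕ} {c : StrictPartition → Zbeta}
    (h : IsHomogeneous e (gqSum c)) : ∃ b : StrictPartition → ℤ,
      (∀ lam, lam.size < e → b lam = 0) ∧
      gqSum c = gqSum fun lam => (b lam : Zbeta) * beta ^ (lam.size - e) := by
  refine ⟨fun lam => if e ≤ lam.size then (c lam).coeff (lam.size - e) else 0,
    fun lam hlam => if_neg (not_le.mpr hlam), MvPowerSeries.ext fun m => ?_⟩
  ext k
  by_cases hk : m.degree = k + e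
  · rw [coeff_gqSum, coeff_gqSum, Polynomial.finsetSum_coeff, Polynomial.finsetSum_coeff]
    refine Finset.sum_congr rfl fun lam hlam => ?_
    have hlam' := mem_sizeLE.mp hlam
    rw [coeff_GQ, ← Polynomial.C_eq_natCast, mul_left_comm, Polynomial.coeff_C_mul,
      mul_left_comm, Polynomial.coeff_C_mul]
    congr 1
    dsimp only
    split_ifs with he
    · obtain ⟨j, hj⟩ : ∃ j, lam.size = j + e := ⟨lam.size - e, by omega⟩
      obtain ⟨i, hi⟩ : ∃ i, k = j + i := ⟨k - j, by omega⟩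
      have h1 : m.degree - lam.size = i := by omega
      have h2 : lam.size - e = j := by omega
      rw [h1, h2, hi, beta, Polynomial.coeff_mul_X_pow, mul_assoc, ← pow_add,
        ← Polynomial.C_eq_intCast, Polynomial.coeff_C_mul, Polynomial.coeff_X_pow, if_pos rfl,
        mul_one]
      simp
    · rw [beta, Polynomial.coeff_mul_X_pow', if_neg (by omega)]
      simp
  · have h1 : (coeff m (gqSum c)).coeff k = 0 := by
      by_contra hne
      exact hk (h m k hne)
    rw [h1, coeff_gqSum, Polynomial.finsetSum_coeff]
    refine (Finset.sum_eq_zero fun lam hlam => ?_).symm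
    have hlam' := mem_sizeLE.mp hlam
    dsimp only
    split_ifs with he
    · rw [coeff_GQ, mul_mul_mul_comm, ← pow_add, ← Polynomial.C_eq_natCast,
        ← Polynomial.C_eq_intCast, ← Polynomial.C_mul, Polynomial.coeff_C_mul, beta,
        Polynomial.coeff_X_pow, if_neg (by omega), mul_zero]
    · simp

theorem isProductExpansion (hjp : JpFormula) (mu nu : StrictPartition) :
    IsProductExpansion mu nu (bCoeff mu nu) := by
  obtain ⟨c, hc⟩ := exists_mul_eq_gqSum hjp mu nu
  obtain ⟨b, hb, hb'⟩ := (hc ▸ (isHomogeneous_GQ mu).mul (isHomogeneous_GQ nu) :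
    IsHomogeneous (mu.size + nu.size) (gqSum c)).exists_int
  refine isProductExpansion_bCoeff ⟨b, isProductExpansion_iff.mpr ⟨hb, ?_⟩⟩
  rw [hc, hb']
  congr 1
  funext lam
  rw [prodCoeff, Nat.sub_sub]

/-! ### Finiteness of the product expansions -/

theorem finite_bCoeff_ne_zero (hjp : JpFormula) (mu nu : StrictPartition) :
    {lam | bCoeff mu nu lam ≠ 0}.Finite := by
  have h := (isProductExpansion_iff.mp (isProductExpansion hjp mu nu)).2
  have hmem : gqSum (prodCoeff mu nu (bCoeff mu nu)) ∈ doubleVarSubalgebra :=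
    h ▸ mul_mem (GQ_mem_doubleVarSubalgebra mu) (GQ_mem_doubleVarSubalgebra nu)
  have hdeg := h ▸ (degreeLE_GQ mu).mul (degreeLE_GQ nu)
  refine (StrictPartition.finite_part_zero_le
    (mu.part 0 + 1 + (nu.part 0 + 1))).subset fun lam hlam => ?_
  refine (part_zero_lt_of_gqSum (by omega) hmem hdeg (lam := lam) ?_).le
  exact mul_ne_zero (Int.cast_ne_zero.mpr hlam) (pow_ne_zero _ beta_ne_zero)

theorem mul_eq_sum (hjp : JpFormula) (mu nu : StrictPartition) :
    GQ mu * GQ nu = ∑ lam ∈ (finite_bCoeff_ne_zero hjp mu nu).toFinset,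
      prodCoeff mu nu (bCoeff mu nu) lam • GQ lam := by
  rw [(isProductExpansion_iff.mp (isProductExpansion hjp mu nu)).2]
  refine gqSum_eq_sum fun lam hlam => ?_
  rw [Set.Finite.mem_toFinset]
  exact Int.cast_ne_zero.mp (left_ne_zero_of_mul hlam)

theorem linearIndependent_GQ : LinearIndependent Zbeta GQ := by
  rw [linearIndependent_iff]
  intro l hl
  have h : gqSum l = gqSum 0 := by
    rw [gqSum_zero, ← hl, Finsupp.linearCombination_apply, Finsupp.sum]
    exact gqSum_eq_sum fun lam h => Finsupp.mem_support_iff.mpr h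
  exact DFunLike.coe_injective (gqSum_injective h)

/-- The span of the functions `GQ`, as a subalgebra. -/
def gqSubalgebra (hjp : JpFormula) : Subalgebra Zbeta PS :=
  (Submodule.span Zbeta (Set.range GQ)).toSubalgebra
    (Submodule.subset_span ⟨.empty, GQ_empty⟩) fun f g hf hg => by
      have h : Submodule.span Zbeta (Set.range GQ) * Submodule.span Zbeta (Set.range GQ) ≤
          Submodule.span Zbeta (Set.range GQ) := by
        rw [Submodule.span_mul_span, Submodule.span_le]
        rintro _ ⟨_, ⟨mu, rfl⟩, _, ⟨nu, rfl⟩, rfl⟩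
        dsimp only
        rw [mul_eq_sum hjp]
        exact Submodule.sum_mem _ fun lam _ =>
          Submodule.smul_mem _ _ (Submodule.subset_span ⟨lam, rfl⟩)
      exact h (Submodule.mul_mem_mul hf hg)

end KSchur

end

open KSchur in
theorem mainTheorem12 (hjp : JpFormula) :
    (∀ mu nu : StrictPartition, {lam | bCoeff mu nu lam ≠ 0}.Finite ∧
      GQ mu * GQ nu =
        ∑ᶠ lam, ((bCoeff mu nu lam : Zbeta) * beta ^ (lam.size - mu.size - nu.size)) • GQ lam) ∧
    ∃ (S : Subalgebra Zbeta PS) (B : Module.Basis StrictPartition Zbeta S),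
      ∀ lam, (B lam : PS) = GQ lam := by
  refine ⟨fun mu nu => ⟨finite_bCoeff_ne_zero hjp mu nu, ?_⟩, gqSubalgebra hjp,
    Module.Basis.span linearIndependent_GQ, fun lam => ?_⟩
  · rw [mul_eq_sum hjp mu nu]
    refine (finsum_eq_sum_of_support_subset _ fun lam hlam => ?_).symm
    rw [Set.Finite.coe_toFinset]
    rintro (h : bCoeff mu nu lam = 0)
    refine hlam ?_
    simp [prodCoeff, h]
  · exact congrArg Subtype.val (Module.Basis.span_apply linearIndependent_GQ lam)
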